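/- Let $\mathbb{H}$, $\mathbb{H}_\alpha$, $\Xi$ be complex Hilbert spaces (norms $|\cdot|$, $|\cdot|_\alpha$, $|\cdot|_\Xi$), with $\mathbb{H}_\alpha$ continuously and densely embedded in $\mathbb{H}$. Let $A$ be the generator of a $C_0$-semigroup $G(t)$ in $\mathbb{H}$ with $\mathcal{D}(A)\subset\mathbb{H}_\alpha$, and suppose that $A$ is also the generator of a $C_0$-semigroup in $\mathbb{H}_\alpha$ (that is, the part of $A$ in $\mathbb{H}_\alpha$ is). Let $B\in\mathcal{L}(\Xi;\mathbb{H})$. Assume **(RES)** $A$ has no spectrum on the imaginary axis, and the operators $(A-i\omega I)^{-1}$ are bounded in the norm of $\mathcal{L}(\mathbb{H};\mathbb{H}_\alpha)$ uniformly in $\omega\in\mathbb{R}$. Let $\mathcal{F}(v,\xi)=(\mathcal{F}_1v,v)_\alpha+2\operatorname{Re}(\mathcal{F}_2v,\xi)_\Xi+(\mathcal{F}_3\xi,\xi)_\Xi$ for $v\in\mathbb{H}_\alpha$, $\xi\in\Xi$, where $\mathcal{F}_1=\mathcal{F}_1^*\in\mathcal{L}(\mathbb{H}_\alpha)$, $\mathcal{F}_2\in\mathcal{L}(\mathbb{H}_\alpha;\Xi)$,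 $\mathcal{F}_3=\mathcal{F}_3^*\in\mathcal{L}(\Xi)$. By a *solution on $[0,T]$* we mean a triple of $v_0\in\mathbb{H}_\alpha$, $\xi(\cdot)\in L_2(0,T;\Xi)$ and $v(\cdot)\in C([0,T];\mathbb{H}_\alpha)$ such that $v(t)=G(t)v_0+\int_0^tG(t-s)B\xi(s)\,ds$ in $\mathbb{H}$ for all $t\in[0,T]$. Put $$\alpha_2:=\inf\frac{\mathcal{F}(v,\xi)}{|v|_\alpha^2+|\xi|_\Xi^2},\qquad \alpha_3:=\inf_{\omega\in\mathbb{R}}\inf_{\xi\ne0}\frac{\mathcal{F}(-(A-i\omega I)^{-1}B\xi,\xi)}{|\xi|_\Xi^2},$$ where the first infimum is over all $\omega\in\mathbb{R}$ and $(v,\xi)\in\mathcal{D}(A)\times\Xi$, $(v,\xi)\neq 0$, with $i\omega v=Av+B\xi$ (and $\inf\emptyset=+\infty$). Then: (a) The following two conditions are equivalent. 1. There is $\delta'>0$ such that $\mathcal{F}(-(A-i\omega I)^{-1}B\xi,\xi)\le-\delta'|\xi|_\Xi^2$ for all $\xi\in\Xi$ and $\omega\in\mathbb{R}$. 2. There are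 $\delta>0$ and a self-adjoint $P\in\mathcal{L}(\mathbb{H}_\alpha)$ such that for $V(v):=(Pv,v)_\alpha$, every $T\ge0$ and every solution on $[0,T]$ $$V(v(T))-V(v_0)+\int_0^T\mathcal{F}(v(s),\xi(s))\,ds\le-\delta\int_0^T\left(|v(s)|_\alpha^2+|\xi(s)|_\Xi^2\right)ds.$$ (b) $\alpha_2>0$ if and only if $\alpha_3>0$. (c) If $\alpha_2>0$, there is a self-adjoint $P\in\mathcal{L}(\mathbb{H}_\alpha)$ such that for $V(v):=(Pv,v)_\alpha$, every $T\ge0$ and every solution on $[0,T]$ we have $V(v(T))-V(v_0)+\int_0^T\mathcal{F}(v(s),\xi(s))\,ds\ge0$. (d) $\alpha_2>0$ if and only if there are $\delta>0$ and a self-adjoint $P\in\mathcal{L}(\mathbb{H}_\alpha)$ such that for $V(v):=(Pv,v)_\alpha$, every $T\ge0$ and every solution on $[0,T]$ $$V(v(T))-V(v_0)+\int_0^T\mathcal{F}(v(s),\xi(s))\,ds\ge\delta\int_0^T\left(|v(s)|_\alpha^2+|\xi(s)|_\Xi^2\right)ds.$$ -/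

import Mathlib

open Set Filter Topology MeasureTheory

namespace FrequencyTheorem

noncomputable section

/-- `G` is a strongly continuous one-parameter semigroup of bounded operators on `E`
(the values `G t` with `t < 0` play no role). -/
structure IsC0Semigroup {E : Type*} [NormedAddCommGroup E] [NormedSpace ℂ E]
    (G : ℝ → E →L[ℂ] E) : Prop where
  map_zero : G 0 = ContinuousLinearMap.id ℂ E
  map_add : ∀ s t : ℝ, 0 ≤ s → 0 ≤ t → G (s + t) = (G s).comp (G t)
  continuousOn : ∀ x : E, ContinuousOn (fun t => G t x) (Ici 0)

/-- `A` is the infinitesimal generator of `G`: `x ∈ D(A)` and `A x = y` if and only if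
`(G h x - x) / h → y` as `h → 0+`. -/
def IsGenerator {E : Type*} [NormedAddCommGroup E] [NormedSpace ℂ E]
    (G : ℝ → E →L[ℂ] E) (A : E →ₗ.[ℂ] E) : Prop :=
  ∀ x y : E, (x, y) ∈ A.graph ↔
    Tendsto (fun h : ℝ => ((h : ℂ)⁻¹) • (G h x - x)) (𝓝[>] 0) (𝓝 y)

/-- `R` is the bounded inverse of `A - z I : D(A) → E`. -/
def IsResolventAt {E : Type*} [NormedAddCommGroup E] [NormedSpace ℂ E]
    (A : E →ₗ.[ℂ] E) (z : ℂ) (R : E →L[ℂ] E) : Prop :=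
  (∀ y : E, ∃ x : A.domain, (x : E) = R y ∧ A x - z • (x : E) = y) ∧
    ∀ x : A.domain, R (A x - z • (x : E)) = x

/-- The spectrum of the (unbounded) operator `A`: those `z` for which `A - z I` has no bounded
everywhere defined inverse. -/
def opSpectrum {E : Type*} [NormedAddCommGroup E] [NormedSpace ℂ E]
    (A : E →ₗ.[ℂ] E) : Set ℂ :=
  {z | ¬ ∃ R : E →L[ℂ] E, IsResolventAt A z R}

open Classical in
/-- The resolvent operator `(A - z I)⁻¹` (set to `0` if `z` lies in the spectrum). -/
def resolventOp {E : Type*} [NormedAddCommGroup E] [NormedSpace ℂ E]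
    (A : E →ₗ.[ℂ] E) (z : ℂ) : E →L[ℂ] E :=
  if h : ∃ R : E →L[ℂ] E, IsResolventAt A z R then h.choose else 0

theorem isResolventAt_resolventOp {E : Type*} [NormedAddCommGroup E] [NormedSpace ℂ E]
    {A : E →ₗ.[ℂ] E} {z : ℂ} (h : z ∉ opSpectrum A) : IsResolventAt A z (resolventOp A z) := by
  have h' : ∃ R : E →L[ℂ] E, IsResolventAt A z R := by simpa [opSpectrum] using h
  rw [resolventOp, dif_pos h']
  exact h'.choose_spec

section Embedded

variable {H Hα Ξ : Type*}
  [NormedAddCommGroup H] [InnerProductSpace ℂ H]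
  [NormedAddCommGroup Hα] [InnerProductSpace ℂ Hα]
  [NormedAddCommGroup Ξ] [InnerProductSpace ℂ Ξ]

/-- The part of `A` in `Hα`, where `Hα` is regarded as a subspace of `H` through the
embedding `ι`: its domain is `{u ∈ Hα | u ∈ D(A), A u ∈ Hα}` and it acts as `A`. -/
def partIn (ι : Hα →L[ℂ] H) (A : H →ₗ.[ℂ] H) : Hα →ₗ.[ℂ] Hα :=
  (A.graph.comap ((ι : Hα →ₗ[ℂ] H).prodMap (ι : Hα →ₗ[ℂ] H))).toLinearPMap

theorem mem_graph_partIn {ι : Hα →L[ℂ] H} (hι : Function.Injective ι) (A : H →ₗ.[ℂ] H)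
    (u w : Hα) : (u, w) ∈ (partIn ι A).graph ↔ (ι u, ι w) ∈ A.graph := by
  rw [partIn, Submodule.toLinearPMap_graph_eq]
  · rfl
  · rintro ⟨a, b⟩ hx h0
    have h0' : a = 0 := h0
    subst h0'
    have h1 : ((ι 0 : H), ι b) ∈ A.graph := hx
    rw [_root_.map_zero] at h1
    have h2 : ι b = 0 := A.graph_fst_eq_zero_snd h1 rfl
    exact hι (by simpa using h2)

/-- `(A - z I)⁻¹ y` as an element of `Hα`, i.e. the unique element of `Hα` that the injective
embedding `ι` maps to `(A - z I)⁻¹ y`. It exists whenever `D(A) ⊆ Hα`. -/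
def resolventInto (ι : Hα →L[ℂ] H) (A : H →ₗ.[ℂ] H) (z : ℂ) (y : H) : Hα :=
  Function.invFun ι (resolventOp A z y)

theorem resolventInto_spec {ι : Hα →L[ℂ] H} {A : H →ₗ.[ℂ] H}
    (hD : ∀ x ∈ A.domain, x ∈ range ι) {z : ℂ} (hz : z ∉ opSpectrum A) (y : H) :
    ι (resolventInto ι A z y) = resolventOp A z y := by
  obtain ⟨x, hx, -⟩ := (isResolventAt_resolventOp hz).1 y
  exact Function.invFun_eq (hx ▸ hD x x.2)

/-- Condition (RES): `A` has no spectrum on the imaginary axis, and the operators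
`(A - i ω I)⁻¹ : H → Hα` are bounded uniformly in `ω`. -/
def RES (ι : Hα →L[ℂ] H) (A : H →ₗ.[ℂ] H) : Prop :=
  (∀ ω : ℝ, Complex.I * ω ∉ opSpectrum A) ∧
    ∃ M : ℝ, ∀ (ω : ℝ) (y : H), ‖resolventInto ι A (Complex.I * ω) y‖ ≤ M * ‖y‖

/-- The Hermitian form `F(v, ξ) = (F₁ v, v)_α + 2 Re (F₂ v, ξ)_Ξ + (F₃ ξ, ξ)_Ξ`. For self-adjoint
`F₁`, `F₃` the first and the last summand are real, so taking real parts changes nothing. -/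
def form (F₁ : Hα →L[ℂ] Hα) (F₂ : Hα →L[ℂ] Ξ) (F₃ : Ξ →L[ℂ] Ξ) (v : Hα) (ξ : Ξ) : ℝ :=
  (inner ℂ (F₁ v) v).re + 2 * (inner ℂ (F₂ v) ξ).re + (inner ℂ (F₃ ξ) ξ).re

/-- `V(v) = (P v, v)_α`, which is real for self-adjoint `P`. -/
def quadForm (P : Hα →L[ℂ] Hα) (v : Hα) : ℝ := (inner ℂ (P v) v).re

/-- The mild solution `v(t, v₀, ξ) = G(t) v₀ + ∫₀ᵗ G(t - s) B ξ(s) ds` in `H`. -/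
def mildSolution (G : ℝ → H →L[ℂ] H) (B : Ξ →L[ℂ] H) (v₀ : H) (ξ : ℝ → Ξ) (t : ℝ) : H :=
  G t v₀ + ∫ s in (0 : ℝ)..t, G (t - s) (B (ξ s))

/-- `ξ ∈ L₂(0, T; Ξ)`, and `v ∈ C([0, T]; Hα)` is the mild solution with `v(0) = v₀ ∈ Hα` and
control `ξ`. -/
structure IsSolutionOn (ι : Hα →L[ℂ] H) (G : ℝ → H →L[ℂ] H) (B : Ξ →L[ℂ] H) (T : ℝ)
    (v₀ : Hα) (ξ : ℝ → Ξ) (v : ℝ → Hα) : Prop where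
  memLp : MemLp ξ 2 (volume.restrict (Icc 0 T))
  continuousOn : ContinuousOn v (Icc 0 T)
  eq_mild : ∀ t ∈ Icc 0 T, ι (v t) = mildSolution G B (ι v₀) ξ t

/-- `α₂`: the infimum of `F(v, ξ) / (|v|_α² + |ξ|²)` over all `ω ∈ ℝ`, `v ∈ D(A)`, `ξ ∈ Ξ` with
`i ω v = A v + B ξ` and `(v, ξ) ≠ 0`. -/
def alphaTwo (ι : Hα →L[ℂ] H) (A : H →ₗ.[ℂ] H) (B : Ξ →L[ℂ] H)
    (F₁ : Hα →L[ℂ] Hα) (F₂ : Hα →L[ℂ] Ξ) (F₃ : Ξ →L[ℂ] Ξ) : EReal :=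
  ⨅ (ω : ℝ) (v : Hα) (ξ : Ξ)
    (_ : ∃ x : A.domain, (x : H) = ι v ∧ (Complex.I * ω) • ι v = A x + B ξ)
    (_ : (v, ξ) ≠ (0, 0)),
    ((form F₁ F₂ F₃ v ξ / (‖v‖ ^ 2 + ‖ξ‖ ^ 2) : ℝ) : EReal)

/-- `α₃`: the infimum of `F(-(A - i ω I)⁻¹ B ξ, ξ) / |ξ|²` over all `ω ∈ ℝ` and `ξ ≠ 0`. -/
def alphaThree (ι : Hα →L[ℂ] H) (A : H →ₗ.[ℂ] H) (B : Ξ →L[ℂ] H)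
    (F₁ : Hα →L[ℂ] Hα) (F₂ : Hα →L[ℂ] Ξ) (F₃ : Ξ →L[ℂ] Ξ) : EReal :=
  ⨅ (ω : ℝ) (ξ : Ξ) (_ : ξ ≠ 0),
    ((form F₁ F₂ F₃ (-resolventInto ι A (Complex.I * ω) (B ξ)) ξ / ‖ξ‖ ^ 2 : ℝ) : EReal)

end Embedded

end

end FrequencyTheorem

/-!
The core is one implication: if `F(-(A - i ω I)⁻¹ B ξ, ξ) ≥ δ |ξ|²` for all `ω` and `ξ`, then there
is a bounded Hermitian form `V` with `V(v(T)) - V(v₀) + ∫ F ≥ 0` along all solutions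
(`exists_quadForm_of_frequency`). As in the theory of optimal control, `V(v₀)` is the least cost
`∫ F` of a process on the half-line that starts from `v₀`.

For this to make sense every `v₀` must be the initial state of a process in `L₂`. So the system is
extended to `v' = A v + B ξ + η` with an auxiliary control `η` in `Hα` and the cost to
`F(v, ξ) + μ |η|²`. Since the resolvent is bounded from `H` to `Hα` uniformly on the imaginary axis,
the frequency inequality persists for large `μ` (`exists_penalty`), while `η` can steer every state
to zero in unit time (`exists_finite_process`). The given solutions are those with `η = 0`.

To avoid unbounded operators, `A⁻¹` is applied to the system: with `z = (v, ξ, η)`, it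
reads `(d/dt) a z = b z` for bounded operators `a` and `b`, and is imposed weakly in time
(`IsWeakProcess`). Mild solutions satisfy it (`resolvent_mild_eq`). The processes with zero initial
state form a closed subspace of `L₂`, on which the cost is coercive: the Fourier transform turns the
equation into `i ω a ẑ = b ẑ`, that is `i ω v̂ = A v̂ + B ξ̂ + η̂`, and Plancherel's theorem applies
(`coercive_zeroProcesses`). Hence the least cost is a bounded Hermitian form of the initial state
(`exists_selfAdjoint_minimum`), and cutting and pasting of processes (`IsWeakProcess.concat`) gives
the dissipation inequality.

The strict inequality follows by subtracting a small multiple of `|v|² + |ξ|²` from `F`, and the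
opposite sign by passing to `-F`. Conversely, the strict inequality along the periodic solutions
`e^{i ω t} (v, ξ)` with `i ω v = A v + B ξ` is the frequency inequality. The relation to `α₂` and
`α₃` is the boundedness of the resolvent once more.
-/

namespace FrequencyTheorem

open scoped InnerProductSpace SchwartzMap FourierTransform

/-! ### Minimisation of a coercive quadratic form -/

/-- The minimum of the form `(Q z, z)` over the affine subspaces `L₀ x + M` is a bounded Hermitian
form `(P x, x)` of `x`, provided that `Q` is coercive on `M`. The minimiser `L x` depends linearly
on `x`, and `P = L* Q L`. -/
theorem exists_selfAdjoint_minimum {X Z : Type*}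
    [NormedAddCommGroup X] [InnerProductSpace ℂ X] [CompleteSpace X]
    [NormedAddCommGroup Z] [InnerProductSpace ℂ Z] [CompleteSpace Z]
    (M : Submodule ℂ Z) (hM : IsClosed (M : Set Z)) (Q : Z →L[ℂ] Z) (hQ : IsSelfAdjoint Q)
    {ε : ℝ} (hε : 0 < ε) (hco : ∀ m ∈ M, ε * ‖m‖ ^ 2 ≤ (⟪Q m, m⟫_ℂ).re) (L₀ : X →L[ℂ] Z) :
    ∃ P : X →L[ℂ] X, IsSelfAdjoint P ∧
      (∀ x, ∀ m ∈ M, (⟪P x, x⟫_ℂ).re ≤ (⟪Q (L₀ x + m), L₀ x + m⟫_ℂ).re) ∧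
      ∀ x, ∃ m ∈ M, (⟪P x, x⟫_ℂ).re = (⟪Q (L₀ x + m), L₀ x + m⟫_ℂ).re := by
  have : CompleteSpace M := hM.completeSpace_coe
  -- the compression of `Q` to `M` is invertible by coercivity
  set K : M →L[ℂ] M := M.orthogonalProjectionOnto ∘L Q ∘L M.subtypeL with hK
  have hKin : ∀ m n : M, ⟪K m, n⟫_ℂ = ⟪Q m, n⟫_ℂ := fun m n => by
    simp [hK]
  have hunit : IsUnit K := by
    refine ContinuousLinearMap.isUnit_of_forall_le_norm_inner_map K (c := ⟨ε, hε.le⟩) hε fun m => ?_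
    rw [hKin]
    calc ‖m‖ ^ 2 * ε = ε * ‖(m : Z)‖ ^ 2 := by rw [mul_comm]; rfl
      _ ≤ _ := hco m m.2
      _ ≤ _ := Complex.re_le_norm _
  obtain ⟨u, hu⟩ := hunit
  set N : X →L[ℂ] Z :=
    M.subtypeL ∘L (↑(u⁻¹) : M →L[ℂ] M) ∘L M.orthogonalProjectionOnto ∘L Q ∘L L₀ with hN
  set L := L₀ - N with hL
  have hNM : ∀ x, N x ∈ M := fun x => by simp [hN]
  have hQs : ∀ y z, ⟪Q y, z⟫_ℂ = ⟪y, Q z⟫_ℂ := fun y z =>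
    (ContinuousLinearMap.isSelfAdjoint_iff_isSymmetric.1 hQ) y z
  -- Euler's equation for the minimiser `L x`
  have horth : ∀ x, ∀ m ∈ M, ⟪Q (L x), m⟫_ℂ = 0 := by
    intro x m hm
    set k : M := (↑(u⁻¹) : M →L[ℂ] M) (M.orthogonalProjectionOnto (Q (L₀ x))) with hk
    have h1 : K k = M.orthogonalProjectionOnto (Q (L₀ x)) := by
      rw [hk, ← hu, ← mul_apply_eq_comp, Units.mul_inv]; rfl
    have h2 : ⟪Q (N x), m⟫_ℂ = ⟪Q (L₀ x), m⟫_ℂ := by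
      have := hKin k ⟨m, hm⟩
      rw [h1] at this
      have hNk : N x = k := rfl
      rw [hNk]
      simpa using this.symm
    simp [hL, h2]
  have hP : ∀ x, ⟪(L.adjoint ∘L Q ∘L L) x, x⟫_ℂ = ⟪Q (L x), L x⟫_ℂ := fun x => by
    simp [ContinuousLinearMap.adjoint_inner_left]
  refine ⟨L.adjoint ∘L Q ∘L L, hQ.adjoint_conj L, fun x m hm => ?_, fun x => ⟨-N x, ?_, ?_⟩⟩
  · have hm' : N x + m ∈ M := M.add_mem (hNM x) hm
    have hdec : L₀ x + m = L x + (N x + m) := by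
      simp only [hL, sub_apply]; abel
    rw [hP, hdec]
    generalize N x + m = n at hm'
    have h0 := hco _ hm'
    have h3 : ⟪Q n, L x⟫_ℂ = 0 := by
      rw [hQs, ← inner_conj_symm, horth x _ hm', map_zero]
    rw [map_add, inner_add_left, inner_add_right, inner_add_right, horth x _ hm', h3]
    have : 0 ≤ ε * ‖n‖ ^ 2 := by positivity
    simp only [add_zero, zero_add, Complex.add_re]
    linarith
  · exact M.neg_mem (hNM x)
  · rw [hP]; simp [hL, sub_eq_add_neg]

/-! ### Weak processes and the Fourier transform -/

section Weak

variable {K H : Type*} [NormedAddCommGroup K] [InnerProductSpace ℂ K]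
  [NormedAddCommGroup H] [InnerProductSpace ℂ H]

/-- Weak form of the evolution equation `(d/dt) a z = b z`, `a z(0) = x₀`, on the half-line: `z`
vanishes for negative times and satisfies the equation when tested against Schwartz functions.
For `z ∈ L₂` this is a closed condition, and the value `x₀` is part of the tested equation, so that
no trace of `a z` at `t = 0` is needed. -/
def IsWeakProcess (a b : K →L[ℂ] H) (x₀ : H) (z : ℝ → K) : Prop :=
  (∀ᵐ t : ℝ, t < 0 → z t = 0) ∧
    ∀ ψ : 𝓢(ℝ, ℂ), a (∫ t, deriv ψ t • z t) + b (∫ t, ψ t • z t) = -(ψ 0 • x₀)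

theorem IsWeakProcess.congr_ae {a b : K →L[ℂ] H} {x₀ : H} {z w : ℝ → K}
    (h : IsWeakProcess a b x₀ z) (hzw : z =ᵐ[volume] w) : IsWeakProcess a b x₀ w := by
  refine ⟨?_, fun ψ => ?_⟩
  · filter_upwards [h.1, hzw] with t h1 h2 ht
    rw [← h2, h1 ht]
  · rw [← h.2 ψ]
    congr 2 <;>
    · refine integral_congr_ae ?_
      filter_upwards [hzw] with t ht
      rw [ht]

theorem integrable_schwartz_smul (ψ : 𝓢(ℝ, ℂ)) {z : ℝ → K} (hz : MemLp z 2 volume) :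
    Integrable (fun t => ψ t • z t) := by
  have := hz.smul (ψ.memLp 2 volume) (r := 1)
  exact memLp_one_iff_integrable.1 this

theorem IsWeakProcess.sub [CompleteSpace K] {a b : K →L[ℂ] H} {x₀ y₀ : H} {z w : ℝ → K}
    (h : IsWeakProcess a b x₀ z) (h' : IsWeakProcess a b y₀ w)
    (hz : MemLp z 2 volume) (hw : MemLp w 2 volume) :
    IsWeakProcess a b (x₀ - y₀) (fun t => z t - w t) := by
  refine ⟨?_, fun ψ => ?_⟩
  · filter_upwards [h.1, h'.1] with t h1 h2 ht
    rw [h1 ht, h2 ht, sub_zero]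
  · have h1 := integral_sub (integrable_schwartz_smul ψ hz) (integrable_schwartz_smul ψ hw)
    have h2 := integral_sub (integrable_schwartz_smul (SchwartzMap.derivCLM ℂ ℂ ψ) hz)
      (integrable_schwartz_smul (SchwartzMap.derivCLM ℂ ℂ ψ) hw)
    simp only [SchwartzMap.derivCLM_apply] at h2
    simp only [smul_sub, h1, h2, map_sub]
    calc _ = (a (∫ t, deriv ψ t • z t) + b (∫ t, ψ t • z t))
          - (a (∫ t, deriv ψ t • w t) + b (∫ t, ψ t • w t)) := by abel
      _ = _ := by rw [h.2 ψ, h'.2 ψ]; abel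

/-- The pairing `z ↦ ∫ ψ z` of an `L₂` function with a Schwartz function. -/
noncomputable def schwartzPairing [CompleteSpace K] (ψ : 𝓢(ℝ, ℂ)) :
    Lp K 2 (volume : Measure ℝ) →L[ℂ] K :=
  PointwiseConvergenceCLM.evalCLM (RingHom.id ℂ) K ψ ∘L Lp.toTemperedDistributionCLM K volume 2

theorem schwartzPairing_apply [CompleteSpace K] (ψ : 𝓢(ℝ, ℂ)) (z : Lp K 2 (volume : Measure ℝ)) :
    schwartzPairing ψ z = ∫ t, ψ t • z t :=
  Lp.toTemperedDistribution_apply z ψ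

/-- The closed subspace of `L₂(ℝ; K)` formed by the weak processes with zero initial state. -/
noncomputable def zeroProcesses [CompleteSpace K] (a b : K →L[ℂ] H) :
    Submodule ℂ (Lp K 2 (volume : Measure ℝ)) :=
  (LpToLpRestrictCLM ℝ K ℂ volume 2 (Iio 0)).ker ⊓
    ⨅ ψ : 𝓢(ℝ, ℂ),
      (a ∘L schwartzPairing (SchwartzMap.derivCLM ℂ ℂ ψ) + b ∘L schwartzPairing ψ).ker

theorem mem_zeroProcesses [CompleteSpace K] {a b : K →L[ℂ] H} {z : Lp K 2 (volume : Measure ℝ)} :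
    z ∈ zeroProcesses a b ↔ IsWeakProcess a b 0 z := by
  have h1 : z ∈ (LpToLpRestrictCLM ℝ K ℂ volume 2 (Iio 0)).ker ↔
      ∀ᵐ t : ℝ, t < 0 → z t = 0 := by
    rw [LinearMap.mem_ker, ContinuousLinearMap.coe_coe, Lp.eq_zero_iff_ae_eq_zero]
    have h := LpToLpRestrictCLM_coeFn ℂ (Iio (0 : ℝ)) z
    have h' : (∀ᵐ t : ℝ, t < 0 → z t = 0) ↔ ∀ᵐ t : ℝ ∂volume.restrict (Iio 0), z t = 0 :=
      (ae_restrict_iff' measurableSet_Iio).symm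
    rw [h']
    constructor <;> intro h' <;> filter_upwards [h, h'] with t h2 h3
    · rw [← h2, h3]; rfl
    · rw [h2, h3]; rfl
  rw [zeroProcesses, Submodule.mem_inf, h1, IsWeakProcess]
  simp [Submodule.mem_iInf, schwartzPairing_apply]

theorem isClosed_zeroProcesses [CompleteSpace K] (a b : K →L[ℂ] H) :
    IsClosed (zeroProcesses a b : Set (Lp K 2 (volume : Measure ℝ))) := by
  rw [zeroProcesses, Submodule.coe_inf, Submodule.coe_iInf]
  exact (ContinuousLinearMap.isClosed_ker _).inter
    (isClosed_iInter fun _ => ContinuousLinearMap.isClosed_ker _)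

/-- The Fourier transform on `L₂` is the transpose of the one on Schwartz functions. -/
theorem schwartzPairing_fourier [CompleteSpace K] (ψ : 𝓢(ℝ, ℂ)) (z : Lp K 2 (volume : Measure ℝ)) :
    schwartzPairing ψ (𝓕 z) = schwartzPairing (𝓕 ψ) z := by
  have := congrArg (fun T : 𝓢'(ℝ, K) => T ψ) (Lp.fourier_toTemperedDistribution_eq z)
  simp only [TemperedDistribution.fourier_apply] at this
  exact this.symm

/-- The Fourier transform on `L₂(ℝ; K)` commutes with bounded operators in `K`. -/
theorem fourier_compLpL [CompleteSpace K] (Φ : K →L[ℂ] K) (z : Lp K 2 (volume : Measure ℝ)) :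
    𝓕 (Φ.compLpL 2 volume z) = Φ.compLpL 2 volume (𝓕 z) := by
  have hcomm : ∀ (ψ : 𝓢(ℝ, ℂ)) (w : Lp K 2 (volume : Measure ℝ)),
      schwartzPairing ψ (Φ.compLpL 2 volume w) = Φ (schwartzPairing ψ w) := fun ψ w => by
    rw [schwartzPairing_apply, schwartzPairing_apply,
      ← Φ.integral_comp_comm (integrable_schwartz_smul ψ (Lp.memLp w))]
    refine integral_congr_ae ?_
    filter_upwards [Φ.coeFn_compLpL (p := 2) (μ := volume) w] with t ht
    rw [ht, map_smul]
  rw [← sub_eq_zero]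
  have hker := Lp.ker_toTemperedDistributionCLM_eq_bot (F := K) (μ := (volume : Measure ℝ)) (p := 2)
  rw [LinearMap.ker_eq_bot'] at hker
  refine hker _ ?_
  ext ψ
  change schwartzPairing ψ _ = 0
  rw [map_sub, schwartzPairing_fourier, hcomm, hcomm, schwartzPairing_fourier, sub_self]

theorem integrable_inner_apply [CompleteSpace K] (Φ : K →L[ℂ] K) {μ : Measure ℝ} {z : ℝ → K}
    (hz : MemLp z 2 μ) : Integrable (fun t => ⟪Φ (z t), z t⟫_ℂ) μ := by
  refine (L2.integrable_inner (𝕜 := ℂ) (Φ.compLpL 2 μ (hz.toLp z)) (hz.toLp z)).congr ?_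
  filter_upwards [Φ.coeFn_compLpL (p := 2) (μ := μ) (hz.toLp z), hz.coeFn_toLp] with x hx hx'
  rw [hx, hx']

theorem re_inner_compLpL [CompleteSpace K] (Φ : K →L[ℂ] K) (z : Lp K 2 (volume : Measure ℝ)) :
    (⟪Φ.compLpL 2 volume z, z⟫_ℂ).re = ∫ t, (⟪Φ (z t), z t⟫_ℂ).re := by
  rw [L2.inner_def, integral_congr_ae (g := fun x => ⟪Φ (z x), z x⟫_ℂ)]
  · exact (integral_re (integrable_inner_apply Φ (Lp.memLp z))).symm
  · filter_upwards [Φ.coeFn_compLpL (p := 2) (μ := volume) z] with x hx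
    rw [hx]

theorem deriv_fourier_schwartz (ψ : 𝓢(ℝ, ℂ)) :
    SchwartzMap.derivCLM ℂ ℂ (𝓕 ψ) =
      𝓕 (-(2 * Real.pi * Complex.I) • SchwartzMap.smulLeftCLM ℂ (fun x : ℝ => x) ψ) := by
  have h := SchwartzMap.lineDerivOp_fourier_eq ψ (1 : ℝ)
  have h1 : (fun x : ℝ => (inner ℝ x 1 : ℝ)) = fun x => x := by ext x; simp
  rw [h1] at h
  rw [← h]
  ext x
  rw [SchwartzMap.lineDerivOp_apply_eq_fderiv, SchwartzMap.derivCLM_apply,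
    fderiv_apply_one_eq_deriv]

/-- The Fourier transform turns `(d/dt) a z = b z` into `i ω a ẑ(ω) = b ẑ(ω)`; in Mathlib's
normalisation `ω = 2 π x`. -/
theorem fourier_zeroProcess [CompleteSpace K] [CompleteSpace H]
    {a b : K →L[ℂ] H} {z : Lp K 2 (volume : Measure ℝ)}
    (hz : z ∈ zeroProcesses a b) :
    ∀ᵐ x : ℝ, (Complex.I * (2 * Real.pi * x : ℝ)) • a ((𝓕 z : Lp K 2 (volume : Measure ℝ)) x)
      = b ((𝓕 z : Lp K 2 (volume : Measure ℝ)) x) := by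
  set w : Lp K 2 (volume : Measure ℝ) := 𝓕 z with hw
  have hloc : LocallyIntegrable w volume := (Lp.memLp w).locallyIntegrable (by norm_num)
  have hcont : Continuous fun x : ℝ => Complex.I * (2 * Real.pi * x : ℝ) := by fun_prop
  have key : ∀ᵐ x : ℝ, b (w x) - (Complex.I * (2 * Real.pi * x : ℝ)) • a (w x) = 0 := by
    refine ae_eq_zero_of_integral_contDiff_smul_eq_zero ?_ fun g hg hgc => ?_
    · refine LocallyIntegrable.sub ?_ ?_
      · exact fun x => (hloc x).imp fun s hs => ⟨hs.1, b.integrable_comp hs.2⟩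
      · have : LocallyIntegrable (fun x => a (w x)) volume := fun x =>
          (hloc x).imp fun s hs => ⟨hs.1, a.integrable_comp hs.2⟩
        rw [← locallyIntegrableOn_univ] at this ⊢
        exact this.continuousOn_smul isOpen_univ.isLocallyClosed hcont.continuousOn
    · have hg₁ : HasCompactSupport (Complex.ofRealCLM ∘ g) := hgc.comp_left rfl
      have hg₂ : ContDiff ℝ ((⊤ : ℕ∞) : WithTop ℕ∞) (Complex.ofRealCLM ∘ g) := by fun_prop
      set ψ := hg₁.toSchwartzMap hg₂ with hψ
      have hψg : ∀ x, ψ x = g x := fun x => rfl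
      -- testing with `𝓕 ψ` in the time domain, whose derivative is `𝓕 χ`
      set χ : 𝓢(ℝ, ℂ) :=
        -(2 * Real.pi * Complex.I) • SchwartzMap.smulLeftCLM ℂ (fun x : ℝ => x) ψ with hχ
      have hχg : ∀ x, χ x = -((Complex.I * (2 * Real.pi * x : ℝ)) * g x) := fun x => by
        have : (fun x : ℝ => x).HasTemperateGrowth := by fun_prop
        simp [hχ, this, hψg]
        ring
      have h1 := (mem_zeroProcesses.1 hz).2 (𝓕 ψ)
      have h2 : a (schwartzPairing χ w) + b (schwartzPairing ψ w) = 0 := by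
        rw [hw, schwartzPairing_fourier, schwartzPairing_fourier, ← deriv_fourier_schwartz,
          schwartzPairing_apply, schwartzPairing_apply]
        simpa using h1
      have i1 := integrable_schwartz_smul χ (Lp.memLp w)
      have i2 := integrable_schwartz_smul ψ (Lp.memLp w)
      rw [schwartzPairing_apply, schwartzPairing_apply, ← a.integral_comp_comm i1,
        ← b.integral_comp_comm i2, ← integral_add (a.integrable_comp i1) (b.integrable_comp i2)]
        at h2
      rw [← h2]
      congr 1
      ext x
      rw [map_smul, map_smul, hχg, hψg, smul_sub, ← Complex.coe_smul, ← Complex.coe_smul, smul_smul,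
        neg_smul, sub_eq_neg_add, mul_comm]
  filter_upwards [key] with x hx
  exact (sub_eq_zero.1 hx).symm

/-- By Plancherel's theorem a pointwise lower bound of the form of `Φ` at each frequency is a lower
bound of its integral along the weak processes with zero initial state. -/
theorem coercive_zeroProcesses [CompleteSpace K] [CompleteSpace H]
    {a b : K →L[ℂ] H} {Φ : K →L[ℂ] K} {ε : ℝ}
    (hfreq : ∀ (ω : ℝ) (k : K), (Complex.I * ω) • a k = b k → ε * ‖k‖ ^ 2 ≤ (⟪Φ k, k⟫_ℂ).re)
    {z : Lp K 2 (volume : Measure ℝ)} (hz : z ∈ zeroProcesses a b) :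
    ε * ‖z‖ ^ 2 ≤ (⟪Φ.compLpL 2 volume z, z⟫_ℂ).re := by
  rw [← Lp.norm_fourier_eq z, ← Lp.inner_fourier_eq, fourier_compLpL]
  have hw := fourier_zeroProcess hz
  generalize (𝓕 z : Lp K 2 (volume : Measure ℝ)) = w at hw
  have i1 : Integrable fun x => ‖w x‖ ^ 2 := (Lp.memLp w).norm.integrable_sq
  have h1 : ‖w‖ ^ 2 = ∫ x, ‖w x‖ ^ 2 := by
    have h := congrArg Complex.re (inner_self_eq_norm_sq_to_K (𝕜 := ℂ) w)
    rw [L2.inner_def] at h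
    simp only [inner_self_eq_norm_sq_to_K] at h
    norm_cast at h
    exact h.symm
  rw [h1, re_inner_compLpL, ← integral_const_mul]
  refine integral_mono_ae (i1.const_mul ε) (integrable_inner_apply Φ (Lp.memLp w)).re ?_
  · filter_upwards [hw] with x hx
    exact hfreq _ _ hx

end Weak

/-! ### Mild solutions of evolution equations -/

section Triangle

variable {E : Type*} [NormedAddCommGroup E] [NormedSpace ℝ E]

/-- Fubini's theorem on the triangle `0 < s < r ≤ T`. -/
theorem integral_triangle_swap {T : ℝ} (hT : 0 ≤ T) {F : ℝ → ℝ → E}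
    (hF : Integrable (Function.uncurry F)
      ((volume.restrict (Ioc 0 T)).prod (volume.restrict (Ioc 0 T)))) :
    ∫ r in (0 : ℝ)..T, ∫ s in (0 : ℝ)..r, F r s = ∫ s in (0 : ℝ)..T, ∫ r in s..T, F r s := by
  have hm : MeasurableSet {p : ℝ × ℝ | p.2 < p.1} := measurableSet_lt measurable_snd measurable_fst
  have h := integral_integral_swap (f := fun r s => if s < r then F r s else 0)
    (μ := volume.restrict (Ioc 0 T)) (ν := volume.restrict (Ioc 0 T)) (by
      refine (hF.indicator hm).congr (Eventually.of_forall fun p => ?_)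
      by_cases hp : p.2 < p.1 <;> simp [hp, Function.uncurry])
  rw [intervalIntegral.integral_of_le hT, intervalIntegral.integral_of_le hT]
  refine Eq.trans ?_ (h.trans ?_)
  · refine setIntegral_congr_fun measurableSet_Ioc fun r hr => ?_
    have h1 : (fun s => if s < r then F r s else 0) = (Iio r).indicator (F r) := by
      ext s; simp [indicator]
    simp only [h1]
    rw [integral_indicator measurableSet_Iio, Measure.restrict_restrict measurableSet_Iio,
      intervalIntegral.integral_of_le hr.1.le, integral_Ioc_eq_integral_Ioo]
    congr 2
    ext s
    simp only [mem_Ioo, mem_inter_iff, mem_Iio, mem_Ioc]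
    exact ⟨fun h => ⟨h.2, h.1, h.2.le.trans hr.2⟩, fun h => ⟨h.2.1, h.1⟩⟩
  · refine setIntegral_congr_fun measurableSet_Ioc fun s hs => ?_
    have h1 : (fun r => if s < r then F r s else 0) = (Ioi s).indicator (fun r => F r s) := by
      ext s; simp [indicator]
    simp only [h1]
    rw [integral_indicator measurableSet_Ioi, Measure.restrict_restrict measurableSet_Ioi,
      intervalIntegral.integral_of_le hs.2]
    congr 2
    ext r
    simp only [mem_Ioi, mem_inter_iff, mem_Ioc]
    exact ⟨fun h => ⟨h.1, h.2.2⟩, fun h => ⟨h.1, hs.1.trans h.1, h.2⟩⟩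

/-- Integration by parts for a primitive `w` of a merely integrable function `g`. -/
theorem integral_deriv_smul_primitive {E : Type*} [NormedAddCommGroup E] [NormedSpace ℂ E]
    [CompleteSpace E]
    (ψ : 𝓢(ℝ, ℂ)) {T : ℝ} (hT : 0 ≤ T) {g w : ℝ → E} {x₀ : E}
    (hg : IntervalIntegrable g volume 0 T)
    (hw : ∀ t ∈ Icc 0 T, w t = x₀ + ∫ s in (0 : ℝ)..t, g s) :
    (∫ t in (0 : ℝ)..T, deriv ψ t • w t) + ∫ t in (0 : ℝ)..T, ψ t • g t
      = ψ T • w T - ψ 0 • x₀ := by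
  have hd : ∀ t, HasDerivAt ψ (deriv ψ t) t := ψ.hasDerivAt
  have hdc : Continuous (deriv ψ) := (SchwartzMap.derivCLM ℂ ℂ ψ).continuous
  have hgi : IntegrableOn g (Ioc 0 T) := (intervalIntegrable_iff_integrableOn_Ioc_of_le hT).1 hg
  have hψ : ∀ s t, ∫ r in s..t, deriv ψ r = ψ t - ψ s := fun s t =>
    intervalIntegral.integral_eq_sub_of_hasDerivAt (fun r _ => hd r) (hdc.intervalIntegrable _ _)
  have hsw := integral_triangle_swap hT (F := fun r s => deriv ψ r • g s)
    (hdc.integrableOn_Ioc.smul_prod hgi)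
  have h1 : ∀ s, ∫ r in s..T, deriv ψ r • g s = ψ T • g s - ψ s • g s := fun s => by
    rw [intervalIntegral.integral_smul_const, hψ, sub_smul]
  have hψg : IntervalIntegrable (fun s => ψ s • g s) volume 0 T :=
    hg.continuousOn_smul ψ.continuous.continuousOn
  have hpc : ContinuousOn (fun t => ∫ s in (0 : ℝ)..t, g s) (uIcc 0 T) :=
    intervalIntegral.continuousOn_primitive_interval' hg left_mem_uIcc
  have h2 : ∫ t in (0 : ℝ)..T, deriv ψ t • w t
      = (ψ T - ψ 0) • x₀ + ∫ t in (0 : ℝ)..T, ∫ s in (0 : ℝ)..t, deriv ψ t • g s := by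
    rw [← hψ, ← intervalIntegral.integral_smul_const, ← intervalIntegral.integral_add]
    · refine intervalIntegral.integral_congr fun t ht => ?_
      rw [uIcc_of_le hT] at ht
      simp only [hw t ht, smul_add, intervalIntegral.integral_smul]
    · exact (hdc.smul continuous_const).intervalIntegrable _ _
    · simp only [intervalIntegral.integral_smul]
      exact (hdc.continuousOn.smul hpc).intervalIntegrable
  rw [h2, hsw]
  simp only [h1]
  have hgT : IntervalIntegrable (fun s => ψ T • g s) volume 0 T := hg.smul _
  rw [intervalIntegral.integral_sub hgT hψg, intervalIntegral.integral_smul,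
    hw T (right_mem_Icc.2 hT), smul_add, sub_smul]
  abel

end Triangle

section Semigroup

variable {E : Type*} [NormedAddCommGroup E] [NormedSpace ℂ E]

theorem IsC0Semigroup.exists_norm_le [CompleteSpace E] {G : ℝ → E →L[ℂ] E} (hG : IsC0Semigroup G)
    (T : ℝ) : ∃ C, 0 ≤ C ∧ ∀ t ∈ Icc 0 T, ‖G t‖ ≤ C := by
  obtain ⟨C, hC⟩ := banach_steinhaus (g := fun t : Icc 0 T => G t) fun x => by
    obtain ⟨C, hC⟩ := (isCompact_Icc (a := 0) (b := T)).exists_bound_of_continuousOn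
      ((hG.continuousOn x).mono Icc_subset_Ici_self)
    exact ⟨C, fun t => hC t t.2⟩
  exact ⟨max C 0, le_max_right _ _, fun t ht => (hC ⟨t, ht⟩).trans (le_max_left _ _)⟩

/-- Joint continuity of `(t, x) ↦ G(t) x`. The semigroup is extended by `G 0` to negative times,
where its values are arbitrary. -/
theorem IsC0Semigroup.continuous_apply [CompleteSpace E] {G : ℝ → E →L[ℂ] E}
    (hG : IsC0Semigroup G) : Continuous fun p : ℝ × E => G (max p.1 0) p.2 := by
  rw [continuous_iff_continuousAt]
  rintro ⟨τ, x⟩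
  obtain ⟨C, hC0, hC⟩ := hG.exists_norm_le (max (τ + 1) 0)
  have h1 : Continuous fun t : ℝ => G (max t 0) x :=
    (hG.continuousOn x).comp_continuous (by fun_prop) fun t => mem_Ici.2 (le_max_right _ _)
  have h2 : Tendsto (fun p : ℝ × E => C * ‖p.2 - x‖ + ‖G (max p.1 0) x - G (max τ 0) x‖)
      (𝓝 (τ, x)) (𝓝 0) := by
    have : Continuous fun p : ℝ × E => C * ‖p.2 - x‖ + ‖G (max p.1 0) x - G (max τ 0) x‖ := by
      have := h1.comp (continuous_fst (X := ℝ) (Y := E))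
      exact (continuous_const.mul (continuous_snd.sub continuous_const).norm).add
        (this.sub continuous_const).norm
    simpa using this.tendsto (τ, x)
  rw [ContinuousAt, tendsto_iff_norm_sub_tendsto_zero]
  refine squeeze_zero' (Eventually.of_forall fun _ => norm_nonneg _) ?_ h2
  have : ∀ᶠ p : ℝ × E in 𝓝 (τ, x), p.1 < τ + 1 :=
    continuous_fst.continuousAt.eventually_lt continuousAt_const (by simp)
  filter_upwards [this] with p hp
  have h3 : G (max p.1 0) p.2 - G (max τ 0) x
      = G (max p.1 0) (p.2 - x) + (G (max p.1 0) x - G (max τ 0) x) := by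
    rw [map_sub]; abel
  rw [h3]
  refine (norm_add_le _ _).trans (add_le_add ?_ le_rfl)
  exact (G _).le_of_opNorm_le (hC _ ⟨le_max_right _ _, max_le_max hp.le le_rfl⟩) _

theorem IsGenerator.apply_mem_graph {G : ℝ → E →L[ℂ] E} {A : E →ₗ.[ℂ] E} (hG : IsC0Semigroup G)
    (hA : IsGenerator G A) {x y : E} (h : (x, y) ∈ A.graph) {t : ℝ} (ht : 0 ≤ t) :
    (G t x, G t y) ∈ A.graph := by
  rw [hA] at h ⊢
  refine (((G t).continuous.tendsto y).comp h).congr' ?_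
  filter_upwards [self_mem_nhdsWithin] with h hh
  have h1 : G h (G t x) = G t (G h x) := by
    rw [← ContinuousLinearMap.comp_apply, ← hG.map_add h t (le_of_lt hh) ht, add_comm,
      hG.map_add t h ht (le_of_lt hh), ContinuousLinearMap.comp_apply]
  simp [h1]

theorem IsGenerator.hasDerivWithinAt {G : ℝ → E →L[ℂ] E} {A : E →ₗ.[ℂ] E} (hG : IsC0Semigroup G)
    (hA : IsGenerator G A) {x y : E} (h : (x, y) ∈ A.graph) {t : ℝ} (ht : 0 ≤ t) :
    HasDerivWithinAt (fun s => G s x) (G t y) (Ioi t) t := by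
  have h1 := (hA _ _).1 (hA.apply_mem_graph hG h ht)
  rw [hasDerivWithinAt_iff_tendsto_slope' (by simp)]
  have h2 : Tendsto (fun s : ℝ => s - t) (𝓝[>] t) (𝓝[>] 0) := by
    refine tendsto_nhdsWithin_iff.2 ⟨?_, ?_⟩
    · have : Tendsto (fun s : ℝ => s - t) (𝓝 t) (𝓝 (t - t)) := (continuous_sub_right t).tendsto t
      rw [sub_self] at this
      exact this.mono_left nhdsWithin_le_nhds
    · filter_upwards [self_mem_nhdsWithin] with s hs
      exact sub_pos.2 (mem_Ioi.1 hs)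
  refine (h1.comp h2).congr' ?_
  filter_upwards [self_mem_nhdsWithin] with s hs
  have h3 : G s x = G (s - t) (G t x) := by
    rw [← ContinuousLinearMap.comp_apply, ← hG.map_add _ _ (sub_pos.2 (mem_Ioi.1 hs)).le ht,
      sub_add_cancel]
  rw [slope_def_module, h3, Function.comp_apply, ← Complex.ofReal_inv, Complex.coe_smul]

theorem IsGenerator.integral_eq [CompleteSpace E] {G : ℝ → E →L[ℂ] E} {A : E →ₗ.[ℂ] E}
    (hG : IsC0Semigroup G) (hA : IsGenerator G A) {x y : E} (h : (x, y) ∈ A.graph) {t : ℝ}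
    (ht : 0 ≤ t) : ∫ r in (0 : ℝ)..t, G r y = G t x - x := by
  rw [intervalIntegral.integral_eq_sub_of_hasDeriv_right_of_le ht (f := fun s => G s x)
    ((hG.continuousOn x).mono Icc_subset_Ici_self)
    (fun s hs => hA.hasDerivWithinAt hG h hs.1.le)]
  · simp [hG.map_zero]
  · refine ContinuousOn.intervalIntegrable ((hG.continuousOn y).mono ?_)
    rw [uIcc_of_le ht]
    exact Icc_subset_Ici_self

theorem IsResolventAt.mem_graph {A : E →ₗ.[ℂ] E} {z : ℂ} {R : E →L[ℂ] E} (hR : IsResolventAt A z R)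
    (y : E) : (R y, y + z • R y) ∈ A.graph := by
  obtain ⟨x, hx, hx'⟩ := hR.1 y
  rw [LinearPMap.mem_graph_iff]
  exact ⟨x, hx, by rw [← hx, ← hx', sub_add_cancel]⟩

theorem IsResolventAt.apply_eq {A : E →ₗ.[ℂ] E} {z : ℂ} {R : E →L[ℂ] E} (hR : IsResolventAt A z R)
    {x y : E} (h : (x, y) ∈ A.graph) : R (y - z • x) = x := by
  obtain ⟨u, hu, hu'⟩ := (LinearPMap.mem_graph_iff _).1 h
  simp only at hu hu'
  rw [← hu', ← hu]
  exact hR.2 u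

theorem resolvent_semigroup_comm {G : ℝ → E →L[ℂ] E} {A : E →ₗ.[ℂ] E}
    (hG : IsC0Semigroup G) (hA : IsGenerator G A) {R : E →L[ℂ] E} (hR : IsResolventAt A 0 R)
    (y : E) {t : ℝ} (ht : 0 ≤ t) : R (G t y) = G t (R y) := by
  have h := hA.apply_mem_graph hG (hR.mem_graph y) ht
  simpa using hR.apply_eq h

theorem integrable_semigroup_sub [CompleteSpace E] {G : ℝ → E →L[ℂ] E} (hG : IsC0Semigroup G)
    {T : ℝ} {f : ℝ → E} (hf : IntegrableOn f (Ioc 0 T)) :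
    Integrable (Function.uncurry fun r s => G (max (r - s) 0) (f s))
      ((volume.restrict (Ioc 0 T)).prod (volume.restrict (Ioc 0 T))) := by
  obtain ⟨C, hC0, hC⟩ := hG.exists_norm_le T
  have hm : AEStronglyMeasurable (Function.uncurry fun r s => G (max (r - s) 0) (f s))
      ((volume.restrict (Ioc 0 T)).prod (volume.restrict (Ioc 0 T))) :=
    hG.continuous_apply.comp_aestronglyMeasurable
      ((measurable_fst.sub measurable_snd).aestronglyMeasurable.prodMk hf.1.comp_snd)
  have hi : Integrable (fun p : ℝ × ℝ => C * ‖f p.2‖)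
      ((volume.restrict (Ioc 0 T)).prod (volume.restrict (Ioc 0 T))) :=
    (hf.norm.comp_snd _).const_mul C
  refine hi.mono' hm ?_
  rw [Measure.prod_restrict]
  filter_upwards [ae_restrict_mem (measurableSet_Ioc.prod measurableSet_Ioc)] with p hp
  refine (G _).le_of_opNorm_le (hC _ ⟨le_max_right _ _, max_le ?_ ?_⟩) _
  · linarith [hp.1.2, hp.2.1]
  · linarith [hp.1.1, hp.1.2]

theorem intervalIntegrable_semigroup_sub [CompleteSpace E] {G : ℝ → E →L[ℂ] E}
    (hG : IsC0Semigroup G) {t : ℝ} (ht : 0 ≤ t) {f : ℝ → E} (hf : IntegrableOn f (Ioc 0 t)) :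
    IntervalIntegrable (fun s => G (t - s) (f s)) volume 0 t := by
  obtain ⟨C, hC0, hC⟩ := hG.exists_norm_le t
  rw [intervalIntegrable_iff_integrableOn_Ioc_of_le ht]
  have hm : AEStronglyMeasurable (fun s => G (max (t - s) 0) (f s)) (volume.restrict (Ioc 0 t)) :=
    hG.continuous_apply.comp_aestronglyMeasurable
      ((measurable_const.sub measurable_id).aestronglyMeasurable.prodMk hf.1)
  have hmax : ∀ s ∈ Ioc 0 t, max (t - s) 0 = t - s := fun s hs => max_eq_left (by linarith [hs.2])
  refine (hf.norm.const_mul C).mono' (hm.congr ?_) ?_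
  · filter_upwards [ae_restrict_mem measurableSet_Ioc] with s hs
    rw [hmax s hs]
  · filter_upwards [ae_restrict_mem measurableSet_Ioc] with s hs
    exact (G _).le_of_opNorm_le (hC _ ⟨by linarith [hs.2], by linarith [hs.1]⟩) _

/-- A mild solution of `u' = A u + f` satisfies the equation obtained from it by applying `A⁻¹` and
integrating in time, in which only bounded operators occur. -/
theorem resolvent_mild_eq [CompleteSpace E] {G : ℝ → E →L[ℂ] E} {A : E →ₗ.[ℂ] E}
    (hG : IsC0Semigroup G) (hA : IsGenerator G A) {R : E →L[ℂ] E} (hR : IsResolventAt A 0 R)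
    {t : ℝ} (ht : 0 ≤ t) {x₀ : E} {f u : ℝ → E} (hf : IntegrableOn f (Ioc 0 t))
    (hu : ContinuousOn u (Icc 0 t))
    (hmild : ∀ s ∈ Icc 0 t, u s = G s x₀ + ∫ r in (0 : ℝ)..s, G (s - r) (f r)) :
    R (u t) = R x₀ + ∫ s in (0 : ℝ)..t, (u s + R (f s)) := by
  have hRG : ∀ (y : E) {τ : ℝ}, 0 ≤ τ → R (G τ y) = R y + ∫ r in (0 : ℝ)..τ, G r y := by
    intro y τ hτ
    have h := hR.mem_graph y
    rw [zero_smul, add_zero] at h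
    rw [hA.integral_eq hG h hτ, resolvent_semigroup_comm hG hA hR y hτ]
    abel
  have hfi : IntervalIntegrable f volume 0 t :=
    (intervalIntegrable_iff_integrableOn_Ioc_of_le ht).2 hf
  have hRf : IntervalIntegrable (fun s => R (f s)) volume 0 t :=
    ⟨R.integrable_comp hfi.1, R.integrable_comp hfi.2⟩
  have hui : IntervalIntegrable u volume 0 t := by
    apply ContinuousOn.intervalIntegrable
    rwa [uIcc_of_le ht]
  have hGi : IntervalIntegrable (fun s => G s x₀) volume 0 t := by
    apply ContinuousOn.intervalIntegrable
    rw [uIcc_of_le ht]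
    exact (hG.continuousOn x₀).mono Icc_subset_Ici_self
  have hcv := intervalIntegrable_semigroup_sub hG ht hf
  have hRcv : IntervalIntegrable (fun s => R (G (t - s) (f s))) volume 0 t :=
    ⟨R.integrable_comp hcv.1, R.integrable_comp hcv.2⟩
  have h1 : ∀ s ∈ uIcc 0 t, R (G (t - s) (f s)) - R (f s) = ∫ r in s..t, G (r - s) (f s) := by
    intro s hs
    rw [uIcc_of_le ht] at hs
    rw [hRG (f s) (sub_nonneg.2 hs.2), add_sub_cancel_left,
      intervalIntegral.integral_comp_sub_right (fun r => G r (f s)) s, sub_self]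
  have hsw := integral_triangle_swap ht (integrable_semigroup_sub hG hf)
  have h2 : ∫ r in (0 : ℝ)..t, (u r - G r x₀)
      = ∫ s in (0 : ℝ)..t, (R (G (t - s) (f s)) - R (f s)) := by
    rw [intervalIntegral.integral_congr h1]
    refine Eq.trans (intervalIntegral.integral_congr fun r hr => ?_) (hsw.trans
      (intervalIntegral.integral_congr fun s hs => ?_))
    · rw [uIcc_of_le ht] at hr
      simp only [hmild r hr, add_sub_cancel_left]
      refine intervalIntegral.integral_congr fun s hs => ?_
      rw [uIcc_of_le hr.1] at hs
      simp only [max_eq_left (sub_nonneg.2 hs.2)]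
    · rw [uIcc_of_le ht] at hs
      refine intervalIntegral.integral_congr fun r hr => ?_
      rw [uIcc_of_le hs.2] at hr
      simp only [max_eq_left (sub_nonneg.2 hr.1)]
  rw [intervalIntegral.integral_sub hui hGi, intervalIntegral.integral_sub hRcv hRf] at h2
  rw [intervalIntegral.integral_add hui hRf, hmild t (right_mem_Icc.2 ht), map_add, hRG x₀ ht,
    ← R.intervalIntegral_comp_comm hcv, ← sub_add_cancel (∫ s in (0 : ℝ)..t, u s)
      (∫ s in (0 : ℝ)..t, G s x₀), h2]
  abel

end Semigroup

/-! ### Concatenation of processes -/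

section Concatenation

variable {K H : Type*} [NormedAddCommGroup K] [InnerProductSpace ℂ K] [CompleteSpace K]
  [NormedAddCommGroup H] [InnerProductSpace ℂ H] [CompleteSpace H]

/-- Weak form of the integrated equation on `[0, T]`, with the boundary terms at both ends. -/
theorem weak_identity_of_interval {a b : K →L[ℂ] H} {T : ℝ} (hT : 0 ≤ T) {z : ℝ → K} {x₀ : H}
    (hz : IntegrableOn z (Ioc 0 T))
    (hmod : ∀ t ∈ Icc 0 T, a (z t) = x₀ + ∫ s in (0 : ℝ)..t, b (z s)) (ψ : 𝓢(ℝ, ℂ)) :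
    a (∫ t, deriv ψ t • (Ioc 0 T).indicator z t) + b (∫ t, ψ t • (Ioc 0 T).indicator z t)
      = ψ T • a (z T) - ψ 0 • x₀ := by
  have hzi : IntervalIntegrable z volume 0 T :=
    (intervalIntegrable_iff_integrableOn_Ioc_of_le hT).2 hz
  have hcut : ∀ φ : ℝ → ℂ, ∫ t, φ t • (Ioc 0 T).indicator z t = ∫ t in (0 : ℝ)..T, φ t • z t := by
    intro φ
    rw [intervalIntegral.integral_of_le hT, ← integral_indicator measurableSet_Ioc]
    congr 1
    ext t
    by_cases ht : t ∈ Ioc 0 T <;> simp [ht]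
  have hi : ∀ φ : 𝓢(ℝ, ℂ), IntervalIntegrable (fun t => φ t • z t) volume 0 T := fun φ =>
    hzi.continuousOn_smul φ.continuous.continuousOn
  have h := integral_deriv_smul_primitive ψ hT (g := fun s => b (z s)) (w := fun s => a (z s))
    ⟨b.integrable_comp hzi.1, b.integrable_comp hzi.2⟩ hmod
  have hi' : IntervalIntegrable (fun t => deriv ψ t • z t) volume 0 T :=
    hi (SchwartzMap.derivCLM ℂ ℂ ψ)
  rw [hcut, hcut, ← h, ← b.intervalIntegral_comp_comm (hi ψ),
    ← a.intervalIntegral_comp_comm hi']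
  simp

/-- A solution on `[0, T]` followed by a weak process that starts from its final state: the boundary
terms at `T` cancel. -/
theorem IsWeakProcess.concat {a b : K →L[ℂ] H} {T : ℝ} (hT : 0 ≤ T) {z w : ℝ → K} {x₀ : H}
    (hz : MemLp z 2 (volume.restrict (Ioc 0 T)))
    (hmod : ∀ t ∈ Icc 0 T, a (z t) = x₀ + ∫ s in (0 : ℝ)..t, b (z s))
    (hw : IsWeakProcess a b (a (z T)) w) (hw2 : MemLp w 2 volume) :
    IsWeakProcess a b x₀ (fun t => (Ioc 0 T).indicator z t + w (t - T)) := by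
  have hzi : MemLp ((Ioc 0 T).indicator z) 2 volume := (memLp_indicator_iff_restrict
    measurableSet_Ioc).2 hz
  have hws : MemLp (fun t => w (t - T)) 2 volume :=
    hw2.comp_measurePreserving (measurePreserving_sub_right volume T)
  refine ⟨?_, fun ψ => ?_⟩
  · have h := (measurePreserving_sub_right volume T).quasiMeasurePreserving.ae hw.1
    filter_upwards [h] with t h1 ht
    rw [h1 (by linarith), indicator_of_notMem (fun h => absurd h.1 (not_lt.2 ht.le)), add_zero]
  · have h1 := weak_identity_of_interval hT (hz.integrable (by norm_num)) hmod ψ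
    have h2 := hw.2 (SchwartzMap.compSubConstCLM ℂ (-T) ψ)
    have hd : ∀ t, deriv (SchwartzMap.compSubConstCLM ℂ (-T) ψ) t = deriv ψ (t + T) := fun t => by
      have : (⇑(SchwartzMap.compSubConstCLM ℂ (-T) ψ)) = fun t => ψ (t + T) := by
        ext t; simp
      rw [this, deriv_comp_add_const]
    simp only [hd] at h2
    have hsh : ∀ φ : ℝ → ℂ, ∫ t, φ (t + T) • w t = ∫ t, φ t • w (t - T) := fun φ => by
      rw [← integral_sub_right_eq_self _ T]
      simp
    rw [hsh] at h2
    simp only [SchwartzMap.compSubConstCLM_apply, sub_neg_eq_add, zero_add] at h2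
    rw [hsh] at h2
    have i1 := integral_add (integrable_schwartz_smul ψ hzi) (integrable_schwartz_smul ψ hws)
    have i2 := integral_add (integrable_schwartz_smul (SchwartzMap.derivCLM ℂ ℂ ψ) hzi)
      (integrable_schwartz_smul (SchwartzMap.derivCLM ℂ ℂ ψ) hws)
    simp only [SchwartzMap.derivCLM_apply] at i2
    simp only [smul_add, i1, i2, map_add]
    calc _ = (a (∫ t, deriv ψ t • (Ioc 0 T).indicator z t) + b (∫ t, ψ t • (Ioc 0 T).indicator z t))
          + (a (∫ t, deriv ψ t • w (t - T)) + b (∫ t, ψ t • w (t - T))) := by abel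
      _ = _ := by rw [h1, h2]; abel

theorem integral_inner_concat (Φ : K →L[ℂ] K) {T : ℝ} (hT : 0 ≤ T) {z w : ℝ → K}
    (hz : MemLp z 2 (volume.restrict (Ioc 0 T))) (hw0 : ∀ᵐ t : ℝ, t < 0 → w t = 0)
    (hw : MemLp w 2 volume) :
    ∫ t, (⟪Φ ((Ioc 0 T).indicator z t + w (t - T)), (Ioc 0 T).indicator z t + w (t - T)⟫_ℂ).re
      = (∫ t in (0 : ℝ)..T, (⟪Φ (z t), z t⟫_ℂ).re) + ∫ t, (⟪Φ (w t), w t⟫_ℂ).re := by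
  have hzi : MemLp ((Ioc 0 T).indicator z) 2 volume := (memLp_indicator_iff_restrict
    measurableSet_Ioc).2 hz
  have hws : MemLp (fun t => w (t - T)) 2 volume :=
    hw.comp_measurePreserving (measurePreserving_sub_right volume T)
  have h0 := (measurePreserving_sub_right volume T).quasiMeasurePreserving.ae hw0
  have hne : ∀ᵐ t : ℝ, t ≠ T := by simp [ae_iff]
  have hsplit : ∀ᵐ t : ℝ,
      (⟪Φ ((Ioc 0 T).indicator z t + w (t - T)), (Ioc 0 T).indicator z t + w (t - T)⟫_ℂ).re
      = (⟪Φ ((Ioc 0 T).indicator z t), (Ioc 0 T).indicator z t⟫_ℂ).re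
        + (⟪Φ (w (t - T)), w (t - T)⟫_ℂ).re := by
    filter_upwards [h0, hne] with t h1 h2
    by_cases ht : t ∈ Ioc 0 T
    · rw [h1 (sub_neg.2 (lt_of_le_of_ne ht.2 h2))]; simp
    · rw [indicator_of_notMem ht]; simp
  have i1 : Integrable fun t => (⟪Φ ((Ioc 0 T).indicator z t), (Ioc 0 T).indicator z t⟫_ℂ).re :=
    (integrable_inner_apply Φ hzi).re
  have i2 : Integrable fun t => (⟪Φ (w (t - T)), w (t - T)⟫_ℂ).re :=
    (integrable_inner_apply Φ hws).re
  rw [integral_congr_ae hsplit, integral_add i1 i2,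
    integral_sub_right_eq_self (fun t => (⟪Φ (w t), w t⟫_ℂ).re) T]
  congr 1
  rw [intervalIntegral.integral_of_le hT, ← integral_indicator measurableSet_Ioc]
  congr 1
  ext t
  by_cases ht : t ∈ Ioc 0 T <;> simp [ht]

end Concatenation

/-! ### The extended system -/

section Extended

variable {H Hα Ξ : Type*}
  [NormedAddCommGroup H] [InnerProductSpace ℂ H]
  [NormedAddCommGroup Hα] [InnerProductSpace ℂ Hα]
  [NormedAddCommGroup Ξ] [InnerProductSpace ℂ Ξ]

variable (Hα Ξ) in
/-- The values `(v, ξ, η)` of the processes of the extended system `v' = A v + B ξ + η`: the state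
`v`, the control `ξ` and the auxiliary control `η`, which takes its values in `Hα`. -/
abbrev ExtSpace := WithLp 2 (Hα × WithLp 2 (Ξ × Hα))

/-- The triple `(v, ξ, η)`. -/
def ExtSpace.mk (v : Hα) (ξ : Ξ) (η : Hα) : ExtSpace Hα Ξ :=
  WithLp.toLp 2 (v, WithLp.toLp 2 (ξ, η))

variable (Hα Ξ) in
/-- The state component. -/
noncomputable def ExtSpace.state : ExtSpace Hα Ξ →L[ℂ] Hα := WithLp.fstL 2 ℂ Hα (WithLp 2 (Ξ × Hα))

variable (Hα Ξ) in
/-- The control component. -/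
noncomputable def ExtSpace.control : ExtSpace Hα Ξ →L[ℂ] Ξ :=
  WithLp.fstL 2 ℂ Ξ Hα ∘L WithLp.sndL 2 ℂ Hα (WithLp 2 (Ξ × Hα))

variable (Hα Ξ) in
/-- The auxiliary control component. -/
noncomputable def ExtSpace.aux : ExtSpace Hα Ξ →L[ℂ] Hα :=
  WithLp.sndL 2 ℂ Ξ Hα ∘L WithLp.sndL 2 ℂ Hα (WithLp 2 (Ξ × Hα))

open ExtSpace

@[simp] theorem state_mk (v : Hα) (ξ : Ξ) (η : Hα) : state Hα Ξ (mk v ξ η) = v := rfl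
@[simp] theorem control_mk (v : Hα) (ξ : Ξ) (η : Hα) : control Hα Ξ (mk v ξ η) = ξ := rfl
@[simp] theorem aux_mk (v : Hα) (ξ : Ξ) (η : Hα) : aux Hα Ξ (mk v ξ η) = η := rfl

theorem ExtSpace.mk_add {Hα Ξ : Type*} [NormedAddCommGroup Hα] [NormedAddCommGroup Ξ]
    (v v' : Hα) (ξ ξ' : Ξ) (η η' : Hα) :
    mk (v + v') (ξ + ξ') (η + η') = mk v ξ η + mk v' ξ' η' := rfl

theorem ExtSpace.mk_smul (c : ℂ) (v : Hα) (ξ : Ξ) (η : Hα) :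
    mk (c • v) (c • ξ) (c • η) = c • mk v ξ η := rfl

theorem ExtSpace.norm_sq (k : ExtSpace Hα Ξ) :
    ‖k‖ ^ 2 = ‖state Hα Ξ k‖ ^ 2 + ‖control Hα Ξ k‖ ^ 2 + ‖aux Hα Ξ k‖ ^ 2 := by
  rw [WithLp.prod_norm_sq_eq_of_L2, WithLp.prod_norm_sq_eq_of_L2, add_assoc]
  rfl

/-- The self-adjoint operator of the Hermitian form `F(v, ξ) + μ |η|²`. -/
noncomputable def extForm [CompleteSpace Hα] [CompleteSpace Ξ]
    (F₁ : Hα →L[ℂ] Hα) (F₂ : Hα →L[ℂ] Ξ) (F₃ : Ξ →L[ℂ] Ξ) (μ : ℝ) :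
    ExtSpace Hα Ξ →L[ℂ] ExtSpace Hα Ξ :=
  (state Hα Ξ).adjoint ∘L F₁ ∘L state Hα Ξ
    + ((control Hα Ξ).adjoint ∘L F₂ ∘L state Hα Ξ
      + (state Hα Ξ).adjoint ∘L F₂.adjoint ∘L control Hα Ξ)
    + (control Hα Ξ).adjoint ∘L F₃ ∘L control Hα Ξ
    + (aux Hα Ξ).adjoint ∘L ((μ : ℂ) • (1 : Hα →L[ℂ] Hα)) ∘L aux Hα Ξ

theorem isSelfAdjoint_extForm [CompleteSpace Hα] [CompleteSpace Ξ]
    {F₁ : Hα →L[ℂ] Hα} (F₂ : Hα →L[ℂ] Ξ) {F₃ : Ξ →L[ℂ] Ξ} (μ : ℝ)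
    (hF₁ : IsSelfAdjoint F₁) (hF₃ : IsSelfAdjoint F₃) : IsSelfAdjoint (extForm F₁ F₂ F₃ μ) := by
  have h1 := hF₁.adjoint_conj (state Hα Ξ)
  have h3 := hF₃.adjoint_conj (control Hα Ξ)
  refine ((h1.add ?_).add h3).add ?_
  · rw [ContinuousLinearMap.isSelfAdjoint_iff']
    simp only [map_add, ContinuousLinearMap.adjoint_comp, ContinuousLinearMap.adjoint_adjoint,
      ContinuousLinearMap.comp_assoc]
    abel
  · have hμ : IsSelfAdjoint ((μ : ℂ) • (1 : Hα →L[ℂ] Hα)) :=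
      IsSelfAdjoint.smul (Complex.conj_ofReal μ) (IsSelfAdjoint.one _)
    exact hμ.adjoint_conj (aux Hα Ξ)

theorem re_inner_extForm [CompleteSpace Hα] [CompleteSpace Ξ]
    (F₁ : Hα →L[ℂ] Hα) (F₂ : Hα →L[ℂ] Ξ) (F₃ : Ξ →L[ℂ] Ξ) (μ : ℝ)
    (k : ExtSpace Hα Ξ) :
    (⟪extForm F₁ F₂ F₃ μ k, k⟫_ℂ).re
      = form F₁ F₂ F₃ (state Hα Ξ k) (control Hα Ξ k) + μ * ‖aux Hα Ξ k‖ ^ 2 := by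
  have h1 : (⟪control Hα Ξ k, F₂ (state Hα Ξ k)⟫_ℂ).re
      = (⟪F₂ (state Hα Ξ k), control Hα Ξ k⟫_ℂ).re :=
    inner_re_symm (𝕜 := ℂ) _ _
  have h2 : (⟪aux Hα Ξ k, aux Hα Ξ k⟫_ℂ).re = ‖aux Hα Ξ k‖ ^ 2 :=
    inner_self_eq_norm_sq (𝕜 := ℂ) _
  simp only [extForm, add_apply, inner_add_left, ContinuousLinearMap.comp_apply,
    ContinuousLinearMap.adjoint_inner_left, smul_apply, one_apply_eq_self, inner_smul_left,
    Complex.conj_ofReal, Complex.add_re, Complex.re_ofReal_mul, h1, h2, form]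
  ring

/-- The operator `a (v, ξ, η) = A⁻¹ v`, where `R` stands for `A⁻¹`. -/
noncomputable def stateMap (ι : Hα →L[ℂ] H) (R : H →L[ℂ] H) : ExtSpace Hα Ξ →L[ℂ] H :=
  R ∘L ι ∘L state Hα Ξ

/-- The operator `b (v, ξ, η) = v + A⁻¹ (B ξ + η)`, so that `(d/dt) a z = b z` is the extended
system after application of `A⁻¹`. Here `R` stands for `A⁻¹`. -/
noncomputable def rateMap (ι : Hα →L[ℂ] H) (B : Ξ →L[ℂ] H) (R : H →L[ℂ] H) :
    ExtSpace Hα Ξ →L[ℂ] H :=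
  ι ∘L state Hα Ξ + R ∘L (B ∘L control Hα Ξ + ι ∘L aux Hα Ξ)

end Extended

/-! ### The frequency inequality and controllability of the extended system -/

section Frequency

open ExtSpace

variable {H Hα Ξ : Type*}
  [NormedAddCommGroup H] [InnerProductSpace ℂ H]
  [NormedAddCommGroup Hα] [InnerProductSpace ℂ Hα]
  [NormedAddCommGroup Ξ] [InnerProductSpace ℂ Ξ]

theorem form_add_left [CompleteSpace Hα] {F₁ : Hα →L[ℂ] Hα} (hF₁ : IsSelfAdjoint F₁)
    (F₂ : Hα →L[ℂ] Ξ) (F₃ : Ξ →L[ℂ] Ξ) (v w : Hα) (ξ : Ξ) :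
    form F₁ F₂ F₃ (v + w) ξ = form F₁ F₂ F₃ v ξ
      + (2 * (⟪F₁ v, w⟫_ℂ).re + (⟪F₁ w, w⟫_ℂ).re + 2 * (⟪F₂ w, ξ⟫_ℂ).re) := by
  have h : (⟪F₁ w, v⟫_ℂ).re = (⟪F₁ v, w⟫_ℂ).re := by
    have := (ContinuousLinearMap.isSelfAdjoint_iff_isSymmetric.1 hF₁) w v
    simp only [ContinuousLinearMap.coe_coe] at this
    rw [this]
    exact inner_re_symm (𝕜 := ℂ) _ _
  simp only [form, map_add, inner_add_left, inner_add_right, Complex.add_re, h]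
  ring

theorem neg_le_re_inner_apply {X Y : Type*} [NormedAddCommGroup X] [InnerProductSpace ℂ X]
    [NormedAddCommGroup Y] [InnerProductSpace ℂ Y] (F : X →L[ℂ] Y) {v : X} {w : Y} {c d : ℝ}
    (hv : ‖v‖ ≤ c) (hw : ‖w‖ ≤ d) : -(‖F‖ * c * d) ≤ (⟪F v, w⟫_ℂ).re := by
  have h1 : ‖⟪F v, w⟫_ℂ‖ ≤ ‖F‖ * c * d := by
    refine (norm_inner_le_norm _ _).trans ?_
    have : 0 ≤ c := (norm_nonneg v).trans hv
    exact mul_le_mul (F.le_opNorm_of_le hv) hw (norm_nonneg _) (by positivity)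
  exact (neg_le_neg h1).trans (neg_le_of_abs_le (Complex.abs_re_le_norm _))

theorem resolventInto_eq_of_graph {ι : Hα →L[ℂ] H} (hι : Function.Injective ι) {A : H →ₗ.[ℂ] H}
    (hD : ∀ x ∈ A.domain, x ∈ range ι) {z : ℂ} (hz : z ∉ opSpectrum A) {v : Hα} {y : H}
    (h : (ι v, z • ι v + y) ∈ A.graph) : v = resolventInto ι A z y := by
  apply hι
  rw [resolventInto_spec hD hz]
  simpa using ((isResolventAt_resolventOp hz).apply_eq h).symm

theorem resolventInto_add {ι : Hα →L[ℂ] H} (hι : Function.Injective ι) {A : H →ₗ.[ℂ] H}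
    (hD : ∀ x ∈ A.domain, x ∈ range ι) {z : ℂ} (hz : z ∉ opSpectrum A) (x y : H) :
    resolventInto ι A z (x + y) = resolventInto ι A z x + resolventInto ι A z y := by
  apply hι
  simp only [map_add, resolventInto_spec hD hz]

theorem resolventInto_neg {ι : Hα →L[ℂ] H} (hι : Function.Injective ι) {A : H →ₗ.[ℂ] H}
    (hD : ∀ x ∈ A.domain, x ∈ range ι) {z : ℂ} (hz : z ∉ opSpectrum A) (x : H) :
    resolventInto ι A z (-x) = -resolventInto ι A z x := by
  apply hι
  simp only [map_neg, resolventInto_spec hD hz]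

theorem RES.exists_bound {ι : Hα →L[ℂ] H} {A : H →ₗ.[ℂ] H} (h : RES ι A) :
    ∃ M : ℝ, 0 ≤ M ∧ ∀ (ω : ℝ) (y : H), ‖resolventInto ι A (Complex.I * ω) y‖ ≤ M * ‖y‖ := by
  obtain ⟨-, M, hM⟩ := h
  exact ⟨max M 0, le_max_right _ _, fun ω y => (hM ω y).trans (by gcongr; exact le_max_left _ _)⟩

theorem RES.zero_notMem {ι : Hα →L[ℂ] H} {A : H →ₗ.[ℂ] H} (h : RES ι A) :
    (0 : ℂ) ∉ opSpectrum A := by simpa using h.1 0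

/-- With a large penalty `μ |η|²` on the auxiliary control, the frequency inequality passes to the
extended system, where moreover the form bounds the full norm of `(v, ξ, η)`. -/
theorem exists_penalty [CompleteSpace Hα] [CompleteSpace Ξ] {A : H →ₗ.[ℂ] H} (B : Ξ →L[ℂ] H)
    {ι : Hα →L[ℂ] H} (hι : Function.Injective ι) (hD : ∀ x ∈ A.domain, x ∈ range ι)
    (hRES : RES ι A) {F₁ : Hα →L[ℂ] Hα} {F₂ : Hα →L[ℂ] Ξ} {F₃ : Ξ →L[ℂ] Ξ} (hF₁ : IsSelfAdjoint F₁)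
    {δ : ℝ} (hδ : 0 < δ) (hfreq : ∀ (ω : ℝ) (ξ : Ξ),
      δ * ‖ξ‖ ^ 2 ≤ form F₁ F₂ F₃ (-resolventInto ι A (Complex.I * ω) (B ξ)) ξ) :
    ∃ μ ε : ℝ, 0 < ε ∧ ∀ (ω : ℝ) (k : ExtSpace Hα Ξ),
      (Complex.I * ω) • stateMap ι (resolventOp A 0) k = rateMap ι B (resolventOp A 0) k →
      ε * ‖k‖ ^ 2 ≤ (⟪extForm F₁ F₂ F₃ μ k, k⟫_ℂ).re := by
  obtain ⟨M, hM0, hM⟩ := hRES.exists_bound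
  set p := M * ‖B‖ with hp
  set q := M * ‖ι‖ with hq
  have hp0 : 0 ≤ p := by positivity
  have hq0 : 0 ≤ q := by positivity
  set c₁ := 2 * (‖F₁‖ * p * q + ‖F₂‖ * q) with hc₁
  set c₂ := ‖F₁‖ * q ^ 2 with hc₂
  -- `F(v, ξ) ≥ δ |ξ|² - c₁ |ξ| |η| - c₂ |η|²`, and the cross term is absorbed by `μ |η|²`
  refine ⟨c₂ + c₁ ^ 2 / (2 * δ) + δ / 2, δ / 2 / (1 + 2 * p ^ 2 + 2 * q ^ 2), by positivity,
    fun ω k hk => ?_⟩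
  have hz := hRES.1 ω
  rw [re_inner_extForm, ExtSpace.norm_sq]
  set v := state Hα Ξ k with hv
  set ξ := control Hα Ξ k with hξ
  set η := aux Hα Ξ k with hη
  have hk' : (Complex.I * ω) • resolventOp A 0 (ι v)
      = ι v + resolventOp A 0 (B ξ + ι η) := hk
  -- `v` solves the stationary equation of the extended system
  have hgraph : (ι v, (Complex.I * ω) • ι v + -(B ξ + ι η)) ∈ A.graph := by
    have h := (isResolventAt_resolventOp hRES.zero_notMem).mem_graph
      ((Complex.I * ω) • ι v + -(B ξ + ι η))
    rw [map_add, map_smul, hk', map_neg, add_neg_cancel_right, zero_smul, add_zero] at h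
    exact h
  have hvdec : v = -resolventInto ι A (Complex.I * ω) (B ξ)
      + -resolventInto ι A (Complex.I * ω) (ι η) := by
    rw [← neg_add, ← resolventInto_add hι hD hz, ← resolventInto_neg hι hD hz]
    exact resolventInto_eq_of_graph hι hD hz hgraph
  set v₁ := -resolventInto ι A (Complex.I * ω) (B ξ) with hv₁
  set v₂ := -resolventInto ι A (Complex.I * ω) (ι η) with hv₂
  have hn₁ : ‖v₁‖ ≤ p * ‖ξ‖ := by
    rw [hv₁, norm_neg, hp, mul_assoc]
    exact (hM _ _).trans (by gcongr; exact B.le_opNorm _)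
  have hn₂ : ‖v₂‖ ≤ q * ‖η‖ := by
    rw [hv₂, norm_neg, hq, mul_assoc]
    exact (hM _ _).trans (by gcongr; exact ι.le_opNorm _)
  have hn : ‖v‖ ^ 2 ≤ 2 * (p * ‖ξ‖) ^ 2 + 2 * (q * ‖η‖) ^ 2 := by
    have h1 : ‖v‖ ≤ p * ‖ξ‖ + q * ‖η‖ := by
      rw [hvdec]; exact (norm_add_le _ _).trans (add_le_add hn₁ hn₂)
    have h2 := pow_le_pow_left₀ (norm_nonneg v) h1 2
    nlinarith [sq_nonneg (p * ‖ξ‖ - q * ‖η‖)]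
  have e1 := neg_le_re_inner_apply F₁ hn₁ hn₂
  have e2 := neg_le_re_inner_apply F₁ hn₂ hn₂
  have e3 := neg_le_re_inner_apply F₂ hn₂ (le_refl ‖ξ‖)
  have e4 := hfreq ω ξ
  rw [hvdec] at hn
  rw [hvdec, form_add_left hF₁]
  rw [← hv₁] at e4
  generalize ‖ξ‖ = x at *
  generalize ‖η‖ = y at *
  generalize ‖v₁ + v₂‖ = r at *
  have hsq : 0 ≤ δ / 2 * x ^ 2 - c₁ * x * y + c₁ ^ 2 / (2 * δ) * y ^ 2 := by
    have : δ / 2 * x ^ 2 - c₁ * x * y + c₁ ^ 2 / (2 * δ) * y ^ 2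
        = (δ * x - c₁ * y) ^ 2 / (2 * δ) := by field_simp; ring
    rw [this]; positivity
  have hlow : δ / 2 * (x ^ 2 + y ^ 2) ≤ form F₁ F₂ F₃ v₁ ξ
      + (2 * (⟪F₁ v₁, v₂⟫_ℂ).re + (⟪F₁ v₂, v₂⟫_ℂ).re + 2 * (⟪F₂ v₂, ξ⟫_ℂ).re)
      + (c₂ + c₁ ^ 2 / (2 * δ) + δ / 2) * y ^ 2 := by
    have : c₁ * x * y = 2 * (‖F₁‖ * (p * x) * (q * y)) + 2 * (‖F₂‖ * (q * y) * x) := by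
      rw [hc₁]; ring
    have : c₂ * y ^ 2 = ‖F₁‖ * (q * y) * (q * y) := by rw [hc₂]; ring
    linarith
  refine le_trans ?_ hlow
  rw [div_mul_eq_mul_div, div_le_iff₀ (by positivity), mul_assoc]
  refine mul_le_mul_of_nonneg_left ?_ (by positivity)
  nlinarith [mul_nonneg (sq_nonneg p) (sq_nonneg y), mul_nonneg (sq_nonneg q) (sq_nonneg x)]

/-- With the auxiliary control every state of `Hα` can be steered to zero in unit time: for the
semigroup `S` in `Hα` the function `v(t) = (1 - t) S(t) x` solves `v' = A v + η` with
`η(t) = -S(t) x`. This is the only place where the semigroup in `Hα` is used. -/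
theorem exists_finite_process [CompleteSpace H] [CompleteSpace Hα] [CompleteSpace Ξ]
    {A : H →ₗ.[ℂ] H} (B : Ξ →L[ℂ] H) {ι : Hα →L[ℂ] H} (hι : Function.Injective ι)
    (hD : ∀ x ∈ A.domain, x ∈ range ι) {R : H →L[ℂ] H} (hR : IsResolventAt A 0 R)
    {S : ℝ → Hα →L[ℂ] Hα} (hS : IsC0Semigroup S) (hSA : IsGenerator S (partIn ι A)) :
    ∃ L : Hα →L[ℂ] Lp (ExtSpace Hα Ξ) 2 (volume : Measure ℝ),
      ∀ x, IsWeakProcess (stateMap ι R) (rateMap ι B R) (R (ι x)) (L x) := by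
  obtain ⟨C, hC0, hC⟩ := hS.exists_norm_le 1
  set z : Hα → ℝ → ExtSpace Hα Ξ := fun x t => mk ((1 - t : ℝ) • S t x) 0 (-S t x) with hz
  have hzadd : ∀ x y t, z (x + y) t = z x t + z y t := fun x y t => by
    simp only [hz, ← ExtSpace.mk_add, map_add, smul_add, neg_add, add_zero]
  have hzsmul : ∀ (c : ℂ) x t, z (c • x) t = c • z x t := fun c x t => by
    simp only [hz, ← ExtSpace.mk_smul, map_smul, smul_neg, smul_zero, smul_comm c (1 - t : ℝ)]
  have hzc : ∀ x, ContinuousOn (z x) (Icc 0 1) := fun x => by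
    have h1 : ContinuousOn (fun t => S t x) (Icc 0 1) :=
      (hS.continuousOn x).mono Icc_subset_Ici_self
    have h2 : ContinuousOn (fun t : ℝ => (1 - t : ℝ) • S t x) (Icc 0 1) :=
      (by fun_prop : ContinuousOn (fun t : ℝ => 1 - t) (Icc 0 1)).smul h1
    have h3 : ContinuousOn (fun t : ℝ => WithLp.toLp 2 ((0 : Ξ), -S t x)) (Icc 0 1) :=
      (WithLp.prod_continuous_toLp 2 Ξ Hα).comp_continuousOn (continuousOn_const.prodMk h1.neg)
    exact (WithLp.prod_continuous_toLp 2 Hα (WithLp 2 (Ξ × Hα))).comp_continuousOn (h2.prodMk h3)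
  have hzb : ∀ x, ∀ t ∈ Icc (0 : ℝ) 1, ‖z x t‖ ≤ 2 * C * ‖x‖ := fun x t ht => by
    have h1 : ‖S t x‖ ≤ C * ‖x‖ := (S t).le_of_opNorm_le (hC t ht) x
    have h2 : ‖(1 - t : ℝ) • S t x‖ ≤ ‖S t x‖ := by
      rw [norm_smul, Real.norm_eq_abs, abs_of_nonneg (by linarith [ht.2])]
      exact mul_le_of_le_one_left (norm_nonneg _) (by linarith [ht.1])
    have h3 : ‖z x t‖ ^ 2 = ‖(1 - t : ℝ) • S t x‖ ^ 2 + ‖(0 : Ξ)‖ ^ 2 + ‖-S t x‖ ^ 2 :=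
      ExtSpace.norm_sq (z x t)
    rw [norm_neg, norm_zero] at h3
    refine abs_le_of_sq_le_sq' ?_ (by positivity) |>.2
    have h4 : 0 ≤ C * ‖x‖ := by positivity
    have h5 := norm_nonneg (S t x)
    have h6 := norm_nonneg ((1 - t : ℝ) • S t x)
    rw [h3]
    nlinarith
  have hmeas : ∀ x, AEStronglyMeasurable (z x) (volume.restrict (Ioc 0 1)) := fun x =>
    ((hzc x).mono Ioc_subset_Icc_self).aestronglyMeasurable measurableSet_Ioc
  have hae : ∀ x, ∀ᵐ t ∂volume.restrict (Ioc (0 : ℝ) 1), ‖z x t‖ ≤ 2 * C * ‖x‖ := fun x =>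
    (ae_restrict_mem measurableSet_Ioc).mono fun t ht => hzb x t (Ioc_subset_Icc_self ht)
  have hmem : ∀ x, MemLp ((Ioc 0 1).indicator (z x)) 2 volume := fun x =>
    (memLp_indicator_iff_restrict measurableSet_Ioc).2
      (MemLp.of_bound (hmeas x) _ (hae x))
  set L₀ : Hα →ₗ[ℂ] Lp (ExtSpace Hα Ξ) 2 (volume : Measure ℝ) :=
    { toFun := fun x => (hmem x).toLp _
      map_add' := fun x y => by
        rw [← MemLp.toLp_add]
        congr 1
        ext1 t
        by_cases ht : t ∈ Ioc (0 : ℝ) 1 <;> simp [ht, hzadd]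
      map_smul' := fun c x => by
        rw [RingHom.id_apply, ← MemLp.toLp_const_smul]
        congr 1
        ext1 t
        by_cases ht : t ∈ Ioc (0 : ℝ) 1 <;> simp [ht, hzsmul] } with hL₀
  refine ⟨L₀.mkContinuous (2 * C) fun x => ?_, fun x => ?_⟩
  · change ‖(hmem x).toLp _‖ ≤ _
    rw [Lp.norm_toLp]
    refine ENNReal.toReal_le_of_le_ofReal (by positivity) ?_
    rw [eLpNorm_indicator_eq_eLpNorm_restrict measurableSet_Ioc]
    refine (eLpNorm_le_of_ae_bound (hae x)).trans ?_
    simp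
  · refine IsWeakProcess.congr_ae (z := (Ioc 0 1).indicator (z x)) ⟨?_, fun ψ => ?_⟩
      (hmem x).coeFn_toLp.symm
    · refine Eventually.of_forall fun t ht => indicator_of_notMem (fun h => ?_) _
      exact absurd h.1 (not_lt.2 ht.le)
    · have hinit : ∀ t ∈ Icc (0 : ℝ) 1, stateMap ι R (z x t)
          = R (ι x) + ∫ s in (0 : ℝ)..t, rateMap ι B R (z x s) := by
        intro t ht
        obtain ⟨u, hu⟩ : R (ι x) ∈ range ι := by
          obtain ⟨y, hy, -⟩ := hR.1 (ι x)
          exact hy ▸ hD y y.2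
        have hux : (u, x) ∈ (partIn ι A).graph := by
          rw [mem_graph_partIn hι, hu]
          simpa only [zero_smul, add_zero] using hR.mem_graph (ι x)
        have hRS : ∀ s, 0 ≤ s → R (ι (S s x)) = ι (S s u) := fun s hs => by
          have h := (mem_graph_partIn hι A _ _).1 (hSA.apply_mem_graph hS hux hs)
          simpa only [zero_smul, sub_zero] using hR.apply_eq h
        have hzs : ∀ s, 0 ≤ s → stateMap ι R (z x s) = (1 - s : ℝ) • ι (S s u) := fun s hs => by
          change R (ι ((1 - s : ℝ) • S s x)) = _
          rw [← hRS s hs]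
          simp only [← Complex.coe_smul, map_smul]
        have hrs : ∀ s, 0 ≤ s → rateMap ι B R (z x s)
            = (1 - s : ℝ) • ι (S s x) + (-1 : ℝ) • ι (S s u) := fun s hs => by
          change ι ((1 - s : ℝ) • S s x) + R (B 0 + ι (-S s x)) = _
          rw [← hRS s hs, map_zero, zero_add, map_neg, map_neg, neg_one_smul]
          simp only [← Complex.coe_smul, map_smul]
        have hcS : ∀ y, ContinuousOn (fun s => ι (S s y)) (Icc 0 t) := fun y =>
          ι.continuous.comp_continuousOn ((hS.continuousOn y).mono Icc_subset_Ici_self)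
        have hc1 : ContinuousOn (fun s : ℝ => 1 - s) (Icc 0 t) := by fun_prop
        have hcong : ∀ s ∈ uIcc 0 t, rateMap ι B R (z x s)
            = (1 - s : ℝ) • ι (S s x) + (-1 : ℝ) • ι (S s u) := fun s hs => by
          rw [uIcc_of_le ht.1] at hs
          exact hrs s hs.1
        -- `A⁻¹ S(s) x = S(s) u` is differentiable from the right, with derivative `S(s) x`
        have hder : ∀ s ∈ Ioo 0 t, HasDerivWithinAt (fun s => (1 - s : ℝ) • ι (S s u))
            ((1 - s : ℝ) • ι (S s x) + (-1 : ℝ) • ι (S s u)) (Ioi s) s := fun s hs => by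
          have hd := (ι.restrictScalars ℝ).hasFDerivAt.comp_hasDerivWithinAt s
            (hSA.hasDerivWithinAt hS hux hs.1.le)
          exact ((hasDerivWithinAt_id s _).const_sub 1).smul hd
        have hint : IntervalIntegrable
            (fun s => (1 - s : ℝ) • ι (S s x) + (-1 : ℝ) • ι (S s u)) volume 0 t := by
          apply ContinuousOn.intervalIntegrable
          rw [uIcc_of_le ht.1]
          exact (hc1.smul (hcS x)).add (continuousOn_const.smul (hcS u))
        rw [intervalIntegral.integral_congr hcong,
          intervalIntegral.integral_eq_sub_of_hasDeriv_right_of_le ht.1 (hc1.smul (hcS u))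
            hder hint, hzs t ht.1]
        simp [hS.map_zero, hu]
      rw [weak_identity_of_interval zero_le_one ?_ hinit ψ]
      · simp [stateMap, hz]
      · exact (hzc x).integrableOn_Icc.mono_set Ioc_subset_Icc_self

end Frequency

/-! ### The optimal cost -/

theorem isSelfAdjoint_compLpL {K : Type*} [NormedAddCommGroup K] [InnerProductSpace ℂ K]
    [CompleteSpace K] {Φ : K →L[ℂ] K} (hΦ : IsSelfAdjoint Φ) :
    IsSelfAdjoint (Φ.compLpL 2 (volume : Measure ℝ)) := by
  rw [ContinuousLinearMap.isSelfAdjoint_iff_isSymmetric] at hΦ ⊢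
  intro z w
  simp only [ContinuousLinearMap.coe_coe]
  rw [L2.inner_def, L2.inner_def]
  refine integral_congr_ae ?_
  filter_upwards [Φ.coeFn_compLpL (p := 2) (μ := volume) z,
    Φ.coeFn_compLpL (p := 2) (μ := volume) w] with t h1 h2
  rw [h1, h2]
  exact hΦ _ _

/-- The least cost `∫ (Φ z, z)` of a weak process with initial state `J x` is a bounded Hermitian
form of `x`, and it is attained. -/
theorem exists_optimal_cost {X K H : Type*} [NormedAddCommGroup X] [InnerProductSpace ℂ X]
    [CompleteSpace X] [NormedAddCommGroup K] [InnerProductSpace ℂ K] [CompleteSpace K]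
    [NormedAddCommGroup H] [InnerProductSpace ℂ H] [CompleteSpace H]
    {a b : K →L[ℂ] H} {Φ : K →L[ℂ] K} (hΦ : IsSelfAdjoint Φ) {ε : ℝ} (hε : 0 < ε)
    (hfreq : ∀ (ω : ℝ) (k : K), (Complex.I * ω) • a k = b k → ε * ‖k‖ ^ 2 ≤ (⟪Φ k, k⟫_ℂ).re)
    {J : X → H} (L₀ : X →L[ℂ] Lp K 2 (volume : Measure ℝ))
    (hL₀ : ∀ x, IsWeakProcess a b (J x) (L₀ x)) :
    ∃ P : X →L[ℂ] X, IsSelfAdjoint P ∧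
      (∀ (x : X) (z : ℝ → K), MemLp z 2 volume → IsWeakProcess a b (J x) z →
        (⟪P x, x⟫_ℂ).re ≤ ∫ t, (⟪Φ (z t), z t⟫_ℂ).re) ∧
      ∀ x : X, ∃ z : ℝ → K, MemLp z 2 volume ∧ IsWeakProcess a b (J x) z ∧
        (⟪P x, x⟫_ℂ).re = ∫ t, (⟪Φ (z t), z t⟫_ℂ).re := by
  obtain ⟨P, hP, hmin, hatt⟩ := exists_selfAdjoint_minimum (zeroProcesses a b)
    (isClosed_zeroProcesses _ _) (Φ.compLpL 2 volume) (isSelfAdjoint_compLpL hΦ) hε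
    (fun m hm => coercive_zeroProcesses hfreq hm) L₀
  refine ⟨P, hP, fun x z hz hzw => ?_, fun x => ?_⟩
  · have hc : IsWeakProcess a b (J x) (hz.toLp z) := hzw.congr_ae hz.coeFn_toLp.symm
    have hcM : hz.toLp z - L₀ x ∈ zeroProcesses a b := by
      rw [mem_zeroProcesses]
      have h := hc.sub (hL₀ x) (Lp.memLp _) (Lp.memLp _)
      rw [sub_self] at h
      exact h.congr_ae (Lp.coeFn_sub _ _).symm
    have h1 := hmin x _ hcM
    rw [add_sub_cancel, re_inner_compLpL] at h1
    refine h1.trans_eq (integral_congr_ae ?_)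
    filter_upwards [hz.coeFn_toLp] with t ht
    rw [ht]
  · obtain ⟨m, hm, hmx⟩ := hatt x
    rw [re_inner_compLpL] at hmx
    refine ⟨_, Lp.memLp _, ?_, hmx⟩
    have h := (hL₀ x).sub (mem_zeroProcesses.1 (neg_mem hm)) (Lp.memLp _) (Lp.memLp _)
    rw [sub_zero] at h
    refine h.congr_ae ?_
    rw [← sub_neg_eq_add]
    exact (Lp.coeFn_sub _ _).symm

section Cost

open ExtSpace

variable {H Hα Ξ : Type*}
  [NormedAddCommGroup H] [InnerProductSpace ℂ H]
  [NormedAddCommGroup Hα] [InnerProductSpace ℂ Hα]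
  [NormedAddCommGroup Ξ] [InnerProductSpace ℂ Ξ]

theorem IsSolutionOn.memLp_mk {ι : Hα →L[ℂ] H} {G : ℝ → H →L[ℂ] H} {B : Ξ →L[ℂ] H} {T : ℝ}
    {v₀ : Hα} {ξ : ℝ → Ξ} {v : ℝ → Hα} (h : IsSolutionOn ι G B T v₀ ξ v) :
    MemLp (fun t => ExtSpace.mk (v t) (ξ t) 0) 2 (volume.restrict (Ioc 0 T)) := by
  have hle : volume.restrict (Ioc 0 T) ≤ volume.restrict (Icc 0 T) :=
    Measure.restrict_mono Ioc_subset_Icc_self le_rfl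
  have hξ := h.memLp.mono_measure hle
  have hvc : ContinuousOn v (Ioc 0 T) := h.continuousOn.mono Ioc_subset_Icc_self
  have hvm := hvc.aestronglyMeasurable measurableSet_Ioc (μ := volume)
  obtain ⟨C, hC⟩ := isCompact_Icc.exists_bound_of_continuousOn h.continuousOn
  have hv : MemLp v 2 (volume.restrict (Ioc 0 T)) := MemLp.of_bound hvm C
    ((ae_restrict_mem measurableSet_Ioc).mono fun t ht => hC t (Ioc_subset_Icc_self ht))
  have hm : AEStronglyMeasurable (fun t => ExtSpace.mk (v t) (ξ t) 0)
      (volume.restrict (Ioc 0 T)) := by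
    have h1 : AEStronglyMeasurable (fun t => WithLp.toLp 2 (ξ t, (0 : Hα)))
        (volume.restrict (Ioc 0 T)) :=
      (WithLp.prod_continuous_toLp 2 Ξ Hα).comp_aestronglyMeasurable
        (hξ.1.prodMk aestronglyMeasurable_const)
    exact (WithLp.prod_continuous_toLp 2 Hα (WithLp 2 (Ξ × Hα))).comp_aestronglyMeasurable
      (hvm.prodMk h1)
  rw [memLp_two_iff_integrable_sq_norm hm]
  refine (hv.norm.integrable_sq.add hξ.norm.integrable_sq).congr (Eventually.of_forall fun t => ?_)
  simp [ExtSpace.norm_sq]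

/-- The frequency inequality yields the dissipation inequality. Here `(P v, v)` is the least cost of
the extended processes that start from `v`; the inequality is Bellman's principle: following a given
solution on `[0, T]` and then an optimal process is one way of starting from `v₀`. -/
theorem exists_quadForm_of_frequency [CompleteSpace H] [CompleteSpace Hα] [CompleteSpace Ξ]
    {A : H →ₗ.[ℂ] H} {G : ℝ → H →L[ℂ] H} (hG : IsC0Semigroup G) (hA : IsGenerator G A)
    (B : Ξ →L[ℂ] H) {ι : Hα →L[ℂ] H} (hι : Function.Injective ι)
    (hD : ∀ x ∈ A.domain, x ∈ range ι)
    (hAα : ∃ S : ℝ → Hα →L[ℂ] Hα, IsC0Semigroup S ∧ IsGenerator S (partIn ι A))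
    (hRES : RES ι A) {F₁ : Hα →L[ℂ] Hα} {F₂ : Hα →L[ℂ] Ξ} {F₃ : Ξ →L[ℂ] Ξ}
    (hF₁ : IsSelfAdjoint F₁) (hF₃ : IsSelfAdjoint F₃) {δ : ℝ} (hδ : 0 < δ)
    (hfreq : ∀ (ω : ℝ) (ξ : Ξ),
      δ * ‖ξ‖ ^ 2 ≤ form F₁ F₂ F₃ (-resolventInto ι A (Complex.I * ω) (B ξ)) ξ) :
    ∃ P : Hα →L[ℂ] Hα, IsSelfAdjoint P ∧
      ∀ (T : ℝ), 0 ≤ T → ∀ (v₀ : Hα) (ξ : ℝ → Ξ) (v : ℝ → Hα), IsSolutionOn ι G B T v₀ ξ v →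
        0 ≤ quadForm P (v T) - quadForm P v₀
          + ∫ s in (0 : ℝ)..T, form F₁ F₂ F₃ (v s) (ξ s) := by
  obtain ⟨μ, ε, hε, hco⟩ := exists_penalty B hι hD hRES hF₁ hδ hfreq
  set R := resolventOp A 0 with hRdef
  have hR : IsResolventAt A 0 R := isResolventAt_resolventOp hRES.zero_notMem
  obtain ⟨S, hS, hSA⟩ := hAα
  obtain ⟨L₀, hL₀⟩ := exists_finite_process B hι hD hR hS hSA
  obtain ⟨P, hP, hmin, hatt⟩ :=
    exists_optimal_cost (isSelfAdjoint_extForm F₂ μ hF₁ hF₃) hε hco L₀ hL₀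
  refine ⟨P, hP, fun T hT v₀ ξ v hsol => ?_⟩
  have hz := hsol.memLp_mk
  set z : ℝ → ExtSpace Hα Ξ := fun t => mk (v t) (ξ t) 0 with hzdef
  -- the solution on `[0, T]` satisfies the integrated equation
  have hmod : ∀ t ∈ Icc 0 T, stateMap ι R (z t)
      = R (ι v₀) + ∫ s in (0 : ℝ)..t, rateMap ι B R (z s) := by
    intro t ht
    have hsub : Icc 0 t ⊆ Icc 0 T := Icc_subset_Icc_right ht.2
    have hξi : IntegrableOn ξ (Ioc 0 t) :=
      IntegrableOn.mono_set (hsol.memLp.integrable (by norm_num))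
        (Ioc_subset_Icc_self.trans hsub)
    have h := resolvent_mild_eq hG hA hR ht.1 (x₀ := ι v₀) (f := fun s => B (ξ s))
      (u := fun s => ι (v s)) (B.integrable_comp hξi)
      (ι.continuous.comp_continuousOn (hsol.continuousOn.mono hsub))
      (fun s hs => hsol.eq_mild s (hsub hs))
    refine h.trans ?_
    congr 1
    refine intervalIntegral.integral_congr fun s _ => ?_
    simp [rateMap, hzdef]
  -- an optimal process from `v T` follows it
  obtain ⟨w, hw2, hw, hwT⟩ := hatt (v T)
  have hc := IsWeakProcess.concat hT hz hmod hw hw2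
  have hcm : MemLp (fun t => (Ioc 0 T).indicator z t + w (t - T)) 2 volume :=
    ((memLp_indicator_iff_restrict measurableSet_Ioc).2 hz).add
      (hw2.comp_measurePreserving (measurePreserving_sub_right volume T))
  have h1 := hmin v₀ _ hcm hc
  rw [integral_inner_concat _ hT hz hw.1 hw2, ← hwT] at h1
  have h2 : ∫ s in (0 : ℝ)..T, (⟪extForm F₁ F₂ F₃ μ (z s), z s⟫_ℂ).re
      = ∫ s in (0 : ℝ)..T, form F₁ F₂ F₃ (v s) (ξ s) := by
    refine intervalIntegral.integral_congr fun s _ => ?_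
    simp only [re_inner_extForm, hzdef, state_mk, control_mk, aux_mk]
    simp
  rw [h2] at h1
  simp only [quadForm]
  linarith

theorem form_sub_smul (F₁ : Hα →L[ℂ] Hα) (F₂ : Hα →L[ℂ] Ξ) (F₃ : Ξ →L[ℂ] Ξ) (c : ℝ) (v : Hα)
    (ξ : Ξ) : form (F₁ - (c : ℂ) • 1) F₂ (F₃ - (c : ℂ) • 1) v ξ
      = form F₁ F₂ F₃ v ξ - c * (‖v‖ ^ 2 + ‖ξ‖ ^ 2) := by
  have h1 : (⟪v, v⟫_ℂ).re = ‖v‖ ^ 2 := inner_self_eq_norm_sq (𝕜 := ℂ) _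
  have h2 : (⟪ξ, ξ⟫_ℂ).re = ‖ξ‖ ^ 2 := inner_self_eq_norm_sq (𝕜 := ℂ) _
  simp only [form, sub_apply, smul_apply, one_apply_eq_self, inner_sub_left, inner_smul_left,
    Complex.conj_ofReal, Complex.sub_re, Complex.re_ofReal_mul, h1, h2]
  ring

theorem form_neg (F₁ : Hα →L[ℂ] Hα) (F₂ : Hα →L[ℂ] Ξ) (F₃ : Ξ →L[ℂ] Ξ) (v : Hα) (ξ : Ξ) :
    form (-F₁) (-F₂) (-F₃) v ξ = -form F₁ F₂ F₃ v ξ := by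
  simp only [form, neg_apply, inner_neg_left, Complex.neg_re]
  ring

theorem quadForm_neg (P : Hα →L[ℂ] Hα) (v : Hα) : quadForm (-P) v = -quadForm P v := by
  simp [quadForm]

theorem IsSolutionOn.integrable_form [CompleteSpace Hα] [CompleteSpace Ξ] {ι : Hα →L[ℂ] H}
    {G : ℝ → H →L[ℂ] H} {B : Ξ →L[ℂ] H} {T : ℝ} (hT : 0 ≤ T)
    {v₀ : Hα} {ξ : ℝ → Ξ} {v : ℝ → Hα} (h : IsSolutionOn ι G B T v₀ ξ v)
    (F₁ : Hα →L[ℂ] Hα) (F₂ : Hα →L[ℂ] Ξ) (F₃ : Ξ →L[ℂ] Ξ) :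
    IntervalIntegrable (fun s => form F₁ F₂ F₃ (v s) (ξ s)) volume 0 T := by
  rw [intervalIntegrable_iff_integrableOn_Ioc_of_le hT]
  have := (integrable_inner_apply (extForm F₁ F₂ F₃ 0) h.memLp_mk).re
  refine this.congr (Eventually.of_forall fun s => ?_)
  exact (re_inner_extForm F₁ F₂ F₃ 0 _).trans (by simp)

theorem IsSolutionOn.integrable_norm_sq {ι : Hα →L[ℂ] H}
    {G : ℝ → H →L[ℂ] H} {B : Ξ →L[ℂ] H} {T : ℝ} (hT : 0 ≤ T)
    {v₀ : Hα} {ξ : ℝ → Ξ} {v : ℝ → Hα} (h : IsSolutionOn ι G B T v₀ ξ v) :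
    IntervalIntegrable (fun s => ‖v s‖ ^ 2 + ‖ξ s‖ ^ 2) volume 0 T := by
  rw [intervalIntegrable_iff_integrableOn_Ioc_of_le hT]
  have := h.memLp_mk.norm.integrable_sq
  refine this.congr (Eventually.of_forall fun s => ?_)
  simp [ExtSpace.norm_sq]

theorem resolventInto_mem_graph {ι : Hα →L[ℂ] H} {A : H →ₗ.[ℂ] H}
    (hD : ∀ x ∈ A.domain, x ∈ range ι) {z : ℂ} (hz : z ∉ opSpectrum A) (y : H) :
    (ι (-resolventInto ι A z y), z • ι (-resolventInto ι A z y) - y) ∈ A.graph := by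
  have h := neg_mem ((isResolventAt_resolventOp hz).mem_graph y)
  rw [map_neg, resolventInto_spec hD hz]
  convert h using 1
  simp [sub_eq_add_neg, add_comm]

/-- The periodic solutions `e^{i ω t} (v, ξ)`, where `i ω v = A v + B ξ`. -/
theorem isSolutionOn_exp [CompleteSpace H] {A : H →ₗ.[ℂ] H} {G : ℝ → H →L[ℂ] H}
    (hG : IsC0Semigroup G) (hA : IsGenerator G A) (B : Ξ →L[ℂ] H) (ι : Hα →L[ℂ] H) {ω : ℝ}
    {v : Hα} {ξ : Ξ} (h : (ι v, (Complex.I * ω) • ι v - B ξ) ∈ A.graph) (T : ℝ) :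
    IsSolutionOn ι G B T v (fun t => Complex.exp (Complex.I * ω * t) • ξ)
      (fun t => Complex.exp (Complex.I * ω * t) • v) := by
  have hexp : Continuous fun t : ℝ => Complex.exp (Complex.I * ω * t) := by fun_prop
  refine ⟨?_, (hexp.smul continuous_const).continuousOn, fun t ht => ?_⟩
  · have hc : Continuous fun t : ℝ => Complex.exp (Complex.I * ω * t) • ξ :=
      hexp.smul continuous_const
    obtain ⟨C, hC⟩ := isCompact_Icc.exists_bound_of_continuousOn (hc.continuousOn (s := Icc 0 T))
    exact MemLp.of_bound hc.aestronglyMeasurable C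
      ((ae_restrict_mem measurableSet_Icc).mono hC)
  · have hcn : Continuous fun s : ℝ => Complex.exp (-(Complex.I * ω * s)) := by fun_prop
    have hder : ∀ s ∈ Ioo 0 t, HasDerivWithinAt
        (fun s : ℝ => Complex.exp (-(Complex.I * ω * s)) • G s (ι v))
        (-(Complex.exp (-(Complex.I * ω * s)) • G s (B ξ))) (Ioi s) s := fun s hs => by
      have h1 := hA.hasDerivWithinAt hG h hs.1.le
      have h2 : HasDerivAt (fun s : ℝ => Complex.exp (-(Complex.I * ω * s)))
          (Complex.exp (-(Complex.I * ω * s)) * -(Complex.I * ω * 1)) s :=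
        (((Complex.ofRealCLM.hasDerivAt (x := s)).const_mul (Complex.I * ω)).neg).cexp
      refine (h2.hasDerivWithinAt.smul h1).congr_deriv ?_
      rw [map_sub, map_smul, smul_sub, smul_smul, mul_one, mul_neg, neg_smul]
      abel
    have hcG : ContinuousOn (fun s : ℝ => Complex.exp (-(Complex.I * ω * s)) • G s (ι v))
        (Icc 0 t) := hcn.continuousOn.smul ((hG.continuousOn _).mono Icc_subset_Ici_self)
    have hint : IntervalIntegrable (fun s : ℝ => -(Complex.exp (-(Complex.I * ω * s)) • G s (B ξ)))
        volume 0 t := by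
      apply ContinuousOn.intervalIntegrable
      rw [uIcc_of_le ht.1]
      exact (hcn.continuousOn.smul ((hG.continuousOn _).mono Icc_subset_Ici_self)).neg
    have hftc := intervalIntegral.integral_eq_sub_of_hasDeriv_right_of_le ht.1 hcG hder hint
    have hconv : ∫ s in (0 : ℝ)..t, G (t - s) (B (Complex.exp (Complex.I * ω * s) • ξ))
        = -(Complex.exp (Complex.I * ω * t) •
            ∫ s in (0 : ℝ)..t, -(Complex.exp (-(Complex.I * ω * s)) • G s (B ξ))) := by
      have h1 := intervalIntegral.integral_comp_sub_left (a := 0) (b := t)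
        (fun s => Complex.exp (Complex.I * ω * (t - s : ℝ)) • G s (B ξ)) t
      rw [sub_self, sub_zero] at h1
      rw [intervalIntegral.integral_neg, smul_neg, neg_neg, ← intervalIntegral.integral_smul]
      refine Eq.trans (intervalIntegral.integral_congr fun s _ => ?_)
        (h1.trans (intervalIntegral.integral_congr fun s _ => ?_))
      · simp only [map_smul, sub_sub_cancel]
      · simp only [smul_smul, ← Complex.exp_add]
        congr 2
        push_cast
        ring
    have hee : Complex.exp (Complex.I * ω * t) * Complex.exp (-(Complex.I * ω * t)) = 1 := by
      rw [← Complex.exp_add, add_neg_cancel, Complex.exp_zero]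
    rw [mildSolution, hconv, hftc, smul_sub, smul_smul, hee]
    simp [hG.map_zero]

end Cost

/-! ### Frequency inequality, dissipation inequality and the infima -/

section Equivalences

variable {H Hα Ξ : Type*}
  [NormedAddCommGroup H] [InnerProductSpace ℂ H]
  [NormedAddCommGroup Hα] [InnerProductSpace ℂ Hα]
  [NormedAddCommGroup Ξ] [InnerProductSpace ℂ Ξ]

theorem inner_apply_smul_of_norm_eq_one {X Y : Type*} [NormedAddCommGroup X] [InnerProductSpace ℂ X]
    [NormedAddCommGroup Y] [InnerProductSpace ℂ Y] (F : X →L[ℂ] Y) {c : ℂ} (hc : ‖c‖ = 1)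
    (x : X) (y : Y) : inner ℂ (F (c • x)) (c • y) = inner ℂ (F x) y := by
  have h : (starRingEnd ℂ) c * c = 1 := by rw [Complex.conj_mul', hc]; simp
  rw [map_smul, inner_smul_left, inner_smul_right, ← mul_assoc, h, one_mul]

theorem form_smul_of_norm_eq_one (F₁ : Hα →L[ℂ] Hα) (F₂ : Hα →L[ℂ] Ξ) (F₃ : Ξ →L[ℂ] Ξ) {c : ℂ}
    (hc : ‖c‖ = 1) (v : Hα) (ξ : Ξ) : form F₁ F₂ F₃ (c • v) (c • ξ) = form F₁ F₂ F₃ v ξ := by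
  simp only [form, inner_apply_smul_of_norm_eq_one _ hc]

theorem quadForm_smul_of_norm_eq_one (P : Hα →L[ℂ] Hα) {c : ℂ} (hc : ‖c‖ = 1) (v : Hα) :
    quadForm P (c • v) = quadForm P v := by
  simp only [quadForm, inner_apply_smul_of_norm_eq_one _ hc]

/-- The frequency inequality `F(-(A - i ω I)⁻¹ B ξ, ξ) ≥ δ |ξ|²`, uniformly in `ω`. -/
def FrequencyInequality (ι : Hα →L[ℂ] H) (A : H →ₗ.[ℂ] H) (B : Ξ →L[ℂ] H)
    (F₁ : Hα →L[ℂ] Hα) (F₂ : Hα →L[ℂ] Ξ) (F₃ : Ξ →L[ℂ] Ξ) : Prop :=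
  ∃ δ : ℝ, 0 < δ ∧ ∀ (ω : ℝ) (ξ : Ξ),
    δ * ‖ξ‖ ^ 2 ≤ form F₁ F₂ F₃ (-resolventInto ι A (Complex.I * ω) (B ξ)) ξ

/-- The strict dissipation inequality with `V(v) = (P v, v)_α`. -/
def StrictDissipation [CompleteSpace Hα] (ι : Hα →L[ℂ] H) (G : ℝ → H →L[ℂ] H) (B : Ξ →L[ℂ] H)
    (F₁ : Hα →L[ℂ] Hα) (F₂ : Hα →L[ℂ] Ξ) (F₃ : Ξ →L[ℂ] Ξ) : Prop :=
  ∃ (δ : ℝ) (P : Hα →L[ℂ] Hα), 0 < δ ∧ IsSelfAdjoint P ∧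
    ∀ (T : ℝ), 0 ≤ T → ∀ (v₀ : Hα) (ξ : ℝ → Ξ) (v : ℝ → Hα), IsSolutionOn ι G B T v₀ ξ v →
      δ * ∫ s in (0 : ℝ)..T, (‖v s‖ ^ 2 + ‖ξ s‖ ^ 2) ≤
        quadForm P (v T) - quadForm P v₀ + ∫ s in (0 : ℝ)..T, form F₁ F₂ F₃ (v s) (ξ s)

theorem norm_resolventInto_apply_le {ι : Hα →L[ℂ] H} {A : H →ₗ.[ℂ] H} (hRES : RES ι A)
    (B : Ξ →L[ℂ] H) : ∃ p : ℝ, ∀ (ω : ℝ) (ξ : Ξ),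
      ‖resolventInto ι A (Complex.I * ω) (B ξ)‖ ^ 2 ≤ p ^ 2 * ‖ξ‖ ^ 2 := by
  obtain ⟨M, hM0, hM⟩ := hRES.exists_bound
  refine ⟨M * ‖B‖, fun ω ξ => ?_⟩
  rw [← mul_pow, mul_assoc]
  refine pow_le_pow_left₀ (norm_nonneg _) ((hM _ _).trans ?_) 2
  gcongr
  exact B.le_opNorm _

/-- The form `F - c (|v|² + |ξ|²)` still satisfies the frequency inequality for small `c > 0`,
because the resolvent is bounded along the imaginary axis. -/
theorem FrequencyInequality.strictDissipation [CompleteSpace H] [CompleteSpace Hα] [CompleteSpace Ξ]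
    {A : H →ₗ.[ℂ] H} {G : ℝ → H →L[ℂ] H} (hG : IsC0Semigroup G) (hA : IsGenerator G A)
    {B : Ξ →L[ℂ] H} {ι : Hα →L[ℂ] H} (hι : Function.Injective ι)
    (hD : ∀ x ∈ A.domain, x ∈ range ι)
    (hAα : ∃ S : ℝ → Hα →L[ℂ] Hα, IsC0Semigroup S ∧ IsGenerator S (partIn ι A))
    (hRES : RES ι A) {F₁ : Hα →L[ℂ] Hα} {F₂ : Hα →L[ℂ] Ξ} {F₃ : Ξ →L[ℂ] Ξ}
    (hF₁ : IsSelfAdjoint F₁) (hF₃ : IsSelfAdjoint F₃)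
    (h : FrequencyInequality ι A B F₁ F₂ F₃) : StrictDissipation ι G B F₁ F₂ F₃ := by
  obtain ⟨δ, hδ, hfreq⟩ := h
  obtain ⟨p, hp⟩ := norm_resolventInto_apply_le hRES B
  set c := δ / 2 / (1 + p ^ 2) with hc
  have hcpos : 0 < c := by positivity
  have hfreq' : ∀ (ω : ℝ) (ξ : Ξ), δ / 2 * ‖ξ‖ ^ 2 ≤ form (F₁ - (c : ℂ) • 1) F₂ (F₃ - (c : ℂ) • 1)
      (-resolventInto ι A (Complex.I * ω) (B ξ)) ξ := fun ω ξ => by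
    have h1 : c * (‖resolventInto ι A (Complex.I * ω) (B ξ)‖ ^ 2 + ‖ξ‖ ^ 2) ≤ δ / 2 * ‖ξ‖ ^ 2 := by
      calc _ ≤ c * (p ^ 2 * ‖ξ‖ ^ 2 + ‖ξ‖ ^ 2) := by gcongr; exact hp ω ξ
        _ = _ := by rw [hc]; field_simp; ring
    rw [form_sub_smul, norm_neg]
    linarith [hfreq ω ξ]
  obtain ⟨P, hP, hdiss⟩ := exists_quadForm_of_frequency hG hA B hι hD hAα hRES
    (hF₁.sub (IsSelfAdjoint.smul (Complex.conj_ofReal c) (IsSelfAdjoint.one _)))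
    (hF₃.sub (IsSelfAdjoint.smul (Complex.conj_ofReal c) (IsSelfAdjoint.one _)))
    (half_pos hδ) hfreq'
  refine ⟨c, P, hcpos, hP, fun T hT v₀ ξ v hsol => ?_⟩
  have h := hdiss T hT v₀ ξ v hsol
  simp only [form_sub_smul] at h
  rw [intervalIntegral.integral_sub (hsol.integrable_form hT F₁ F₂ F₃)
    ((hsol.integrable_norm_sq hT).const_mul c), intervalIntegral.integral_const_mul] at h
  linarith

/-- Along the periodic solution `e^{i ω t} (v, ξ)` the forms `V` and `F` are constant. -/
theorem StrictDissipation.frequencyInequality [CompleteSpace H] [CompleteSpace Hα]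
    {A : H →ₗ.[ℂ] H} {G : ℝ → H →L[ℂ] H} (hG : IsC0Semigroup G) (hA : IsGenerator G A)
    {B : Ξ →L[ℂ] H} {ι : Hα →L[ℂ] H} (hD : ∀ x ∈ A.domain, x ∈ range ι)
    (hRES : RES ι A) {F₁ : Hα →L[ℂ] Hα} {F₂ : Hα →L[ℂ] Ξ} {F₃ : Ξ →L[ℂ] Ξ}
    (h : StrictDissipation ι G B F₁ F₂ F₃) : FrequencyInequality ι A B F₁ F₂ F₃ := by
  obtain ⟨δ, P, hδ, -, hdiss⟩ := h
  refine ⟨δ, hδ, fun ω ξ => ?_⟩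
  set v := -resolventInto ι A (Complex.I * ω) (B ξ) with hv
  have hexp : ∀ t : ℝ, ‖Complex.exp (Complex.I * ω * t)‖ = 1 := fun t => by
    rw [Complex.norm_exp]; simp
  have hsol := isSolutionOn_exp hG hA B ι (resolventInto_mem_graph hD (hRES.1 ω) (B ξ)) 1
  have h1 := hdiss 1 zero_le_one _ _ _ hsol
  simp only [form_smul_of_norm_eq_one _ _ _ (hexp _), quadForm_smul_of_norm_eq_one _ (hexp _),
    norm_smul, hexp, one_mul, sub_self, zero_add, intervalIntegral.integral_const, sub_zero,
    one_smul] at h1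
  rw [← hv] at h1
  nlinarith [sq_nonneg ‖v‖, mul_nonneg hδ.le (sq_nonneg ‖v‖)]

theorem frequencyInequality_iff_alphaThree_pos {ι : Hα →L[ℂ] H} (hι : Function.Injective ι)
    {A : H →ₗ.[ℂ] H} (hD : ∀ x ∈ A.domain, x ∈ range ι) (hRES : RES ι A) (B : Ξ →L[ℂ] H)
    (F₁ : Hα →L[ℂ] Hα) (F₂ : Hα →L[ℂ] Ξ) (F₃ : Ξ →L[ℂ] Ξ) :
    FrequencyInequality ι A B F₁ F₂ F₃ ↔ 0 < alphaThree ι A B F₁ F₂ F₃ := by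
  constructor
  · rintro ⟨δ, hδ, h⟩
    refine (EReal.coe_pos.2 hδ).trans_le (le_iInf fun ω => le_iInf fun ξ => le_iInf fun hξ => ?_)
    have : 0 < ‖ξ‖ := norm_pos_iff.2 hξ
    rw [EReal.coe_le_coe_iff, le_div_iff₀ (by positivity)]
    exact h ω ξ
  · intro h
    obtain ⟨δ, hδ0, hδ⟩ := EReal.lt_iff_exists_real_btwn.1 h
    refine ⟨δ, EReal.coe_pos.1 hδ0, fun ω ξ => ?_⟩
    by_cases hξ : ξ = 0
    · have h0 : resolventInto ι A (Complex.I * ω) 0 = 0 :=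
        hι (by rw [resolventInto_spec hD (hRES.1 ω), map_zero, map_zero])
      simp [hξ, h0, form]
    · have h1 := hδ.le.trans ((iInf_le _ ω).trans ((iInf_le _ ξ).trans (iInf_le _ hξ)))
      have : 0 < ‖ξ‖ := norm_pos_iff.2 hξ
      rwa [EReal.coe_le_coe_iff, le_div_iff₀ (by positivity)] at h1

theorem frequencyInequality_iff_alphaTwo_pos {ι : Hα →L[ℂ] H} (hι : Function.Injective ι)
    {A : H →ₗ.[ℂ] H} (hD : ∀ x ∈ A.domain, x ∈ range ι) (hRES : RES ι A) (B : Ξ →L[ℂ] H)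
    (F₁ : Hα →L[ℂ] Hα) (F₂ : Hα →L[ℂ] Ξ) (F₃ : Ξ →L[ℂ] Ξ) :
    FrequencyInequality ι A B F₁ F₂ F₃ ↔ 0 < alphaTwo ι A B F₁ F₂ F₃ := by
  constructor
  · rintro ⟨δ, hδ, h⟩
    obtain ⟨p, hp⟩ := norm_resolventInto_apply_le hRES B
    have hε : 0 < δ / (1 + p ^ 2) := by positivity
    refine (EReal.coe_pos.2 hε).trans_le (le_iInf fun ω => le_iInf fun v => le_iInf fun ξ =>
      le_iInf fun hv => le_iInf fun hne => ?_)
    obtain ⟨x, hx, hxv⟩ := hv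
    have hgraph : (ι v, (Complex.I * ω) • ι v + B (-ξ)) ∈ A.graph := by
      rw [LinearPMap.mem_graph_iff]
      exact ⟨x, hx, by rw [hxv, map_neg, add_neg_cancel_right]⟩
    have hveq : v = -resolventInto ι A (Complex.I * ω) (B ξ) := by
      rw [← resolventInto_neg hι hD (hRES.1 ω), ← map_neg]
      exact resolventInto_eq_of_graph hι hD (hRES.1 ω) hgraph
    have hpos : 0 < ‖v‖ ^ 2 + ‖ξ‖ ^ 2 := by
      rcases eq_or_ne ξ 0 with h0 | h0
      · have : v ≠ 0 := fun h1 => hne (by rw [h0, h1])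
        have := norm_pos_iff.2 this
        positivity
      · have := norm_pos_iff.2 h0
        positivity
    have hle : ‖v‖ ^ 2 ≤ p ^ 2 * ‖ξ‖ ^ 2 := by rw [hveq, norm_neg]; exact hp ω ξ
    rw [EReal.coe_le_coe_iff, le_div_iff₀ hpos]
    have h1 := h ω ξ
    rw [← hveq] at h1
    refine le_trans ?_ h1
    rw [div_mul_eq_mul_div, div_le_iff₀ (by positivity), mul_assoc]
    exact mul_le_mul_of_nonneg_left (by linarith) hδ.le
  · intro h
    obtain ⟨δ, hδ0, hδ⟩ := EReal.lt_iff_exists_real_btwn.1 h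
    have hδ0' : 0 < δ := EReal.coe_pos.1 hδ0
    refine ⟨δ, hδ0', fun ω ξ => ?_⟩
    have hg := resolventInto_mem_graph hD (hRES.1 ω) (B ξ)
    set v := -resolventInto ι A (Complex.I * ω) (B ξ) with hv
    by_cases hne : (v, ξ) = (0, 0)
    · obtain ⟨h1, h2⟩ := Prod.mk.inj hne
      simp [h1, h2, form]
    · obtain ⟨x, hx, hx'⟩ := (LinearPMap.mem_graph_iff _).1 hg
      have heq : ∃ x : A.domain, (x : H) = ι v ∧ (Complex.I * ω) • ι v = A x + B ξ :=
        ⟨x, hx, by rw [hx', sub_add_cancel]⟩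
      have h1 := hδ.le.trans ((iInf_le _ ω).trans ((iInf_le _ v).trans ((iInf_le _ ξ).trans
        ((iInf_le _ heq).trans (iInf_le _ hne)))))
      have hpos : 0 < ‖v‖ ^ 2 + ‖ξ‖ ^ 2 := by
        by_contra hcon
        have h2 : ‖v‖ ^ 2 = 0 := by nlinarith [sq_nonneg ‖v‖, sq_nonneg ‖ξ‖]
        have h3 : ‖ξ‖ ^ 2 = 0 := by nlinarith [sq_nonneg ‖v‖, sq_nonneg ‖ξ‖]
        exact hne (Prod.ext (by simpa using h2) (by simpa using h3))
      rw [EReal.coe_le_coe_iff, le_div_iff₀ hpos] at h1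
      nlinarith [sq_nonneg ‖v‖, sq_nonneg ‖ξ‖, mul_nonneg hδ0'.le (sq_nonneg ‖v‖)]

end Equivalences

end FrequencyTheorem

theorem theorem1 {H Hα Ξ : Type*}
    [NormedAddCommGroup H] [InnerProductSpace ℂ H] [CompleteSpace H]
    [NormedAddCommGroup Hα] [InnerProductSpace ℂ Hα] [CompleteSpace Hα]
    [NormedAddCommGroup Ξ] [InnerProductSpace ℂ Ξ] [CompleteSpace Ξ]
    -- the operator `A` generates the semigroup `G` in `H`
    (A : H →ₗ.[ℂ] H) (G : ℝ → H →L[ℂ] H)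
    (hG : FrequencyTheorem.IsC0Semigroup G) (hA : FrequencyTheorem.IsGenerator G A)
    (B : Ξ →L[ℂ] H)
    -- the continuous and dense embedding of `Hα` into `H`, with `D(A) ⊆ Hα`
    (ι : Hα →L[ℂ] H) (hι : Function.Injective ι) (hdense : DenseRange ι)
    (hD : ∀ x ∈ A.domain, x ∈ Set.range ι)
    -- the operator `A` also generates a semigroup in `Hα`
    (hAα : ∃ S : ℝ → Hα →L[ℂ] Hα, FrequencyTheorem.IsC0Semigroup S ∧
      FrequencyTheorem.IsGenerator S (FrequencyTheorem.partIn ι A))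
    (hRES : FrequencyTheorem.RES ι A)
    (F₁ : Hα →L[ℂ] Hα) (F₂ : Hα →L[ℂ] Ξ) (F₃ : Ξ →L[ℂ] Ξ)
    (hF₁ : IsSelfAdjoint F₁) (hF₃ : IsSelfAdjoint F₃) :
    -- the frequency inequality is equivalent to the strict dissipation inequality
    ((∃ δ' : ℝ, 0 < δ' ∧ ∀ (ω : ℝ) (ξ : Ξ),
        FrequencyTheorem.form F₁ F₂ F₃
          (-FrequencyTheorem.resolventInto ι A (Complex.I * ω) (B ξ)) ξ ≤ -δ' * ‖ξ‖ ^ 2) ↔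
      ∃ (δ : ℝ) (P : Hα →L[ℂ] Hα), 0 < δ ∧ IsSelfAdjoint P ∧
        ∀ (T : ℝ), 0 ≤ T → ∀ (v₀ : Hα) (ξ : ℝ → Ξ) (v : ℝ → Hα),
          FrequencyTheorem.IsSolutionOn ι G B T v₀ ξ v →
          FrequencyTheorem.quadForm P (v T) - FrequencyTheorem.quadForm P v₀
              + ∫ s in (0 : ℝ)..T, FrequencyTheorem.form F₁ F₂ F₃ (v s) (ξ s)
            ≤ -δ * ∫ s in (0 : ℝ)..T, (‖v s‖ ^ 2 + ‖ξ s‖ ^ 2)) ∧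
    -- positivity of `α₂` and of `α₃` are equivalent
    (0 < FrequencyTheorem.alphaTwo ι A B F₁ F₂ F₃ ↔
      0 < FrequencyTheorem.alphaThree ι A B F₁ F₂ F₃) ∧
    -- positivity of `α₂` yields the non-strict inequality with the opposite sign
    (0 < FrequencyTheorem.alphaTwo ι A B F₁ F₂ F₃ →
      ∃ P : Hα →L[ℂ] Hα, IsSelfAdjoint P ∧
        ∀ (T : ℝ), 0 ≤ T → ∀ (v₀ : Hα) (ξ : ℝ → Ξ) (v : ℝ → Hα),
          FrequencyTheorem.IsSolutionOn ι G B T v₀ ξ v →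
          0 ≤ FrequencyTheorem.quadForm P (v T) - FrequencyTheorem.quadForm P v₀
              + ∫ s in (0 : ℝ)..T, FrequencyTheorem.form F₁ F₂ F₃ (v s) (ξ s)) ∧
    -- positivity of `α₂` is equivalent to the strict inequality with the opposite sign
    (0 < FrequencyTheorem.alphaTwo ι A B F₁ F₂ F₃ ↔
      ∃ (δ : ℝ) (P : Hα →L[ℂ] Hα), 0 < δ ∧ IsSelfAdjoint P ∧
        ∀ (T : ℝ), 0 ≤ T → ∀ (v₀ : Hα) (ξ : ℝ → Ξ) (v : ℝ → Hα),
          FrequencyTheorem.IsSolutionOn ι G B T v₀ ξ v →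
          δ * ∫ s in (0 : ℝ)..T, (‖v s‖ ^ 2 + ‖ξ s‖ ^ 2) ≤
            FrequencyTheorem.quadForm P (v T) - FrequencyTheorem.quadForm P v₀
              + ∫ s in (0 : ℝ)..T, FrequencyTheorem.form F₁ F₂ F₃ (v s) (ξ s)) := by
  have hfd : ∀ {F₁ : Hα →L[ℂ] Hα} {F₂ : Hα →L[ℂ] Ξ} {F₃ : Ξ →L[ℂ] Ξ}, IsSelfAdjoint F₁ →
      IsSelfAdjoint F₃ → (FrequencyTheorem.FrequencyInequality ι A B F₁ F₂ F₃ ↔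
        FrequencyTheorem.StrictDissipation ι G B F₁ F₂ F₃) := fun h₁ h₃ =>
    ⟨fun h => h.strictDissipation hG hA hι hD hAα hRES h₁ h₃,
      fun h => h.frequencyInequality hG hA hD hRES⟩
  have h2 := FrequencyTheorem.frequencyInequality_iff_alphaTwo_pos hι hD hRES B F₁ F₂ F₃
  have h3 := FrequencyTheorem.frequencyInequality_iff_alphaThree_pos hι hD hRES B F₁ F₂ F₃
  have hd := h2.symm.trans (hfd (F₂ := F₂) hF₁ hF₃)
  refine ⟨?_, h2.symm.trans h3, fun hpos => ?_, hd⟩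
  · -- the inequalities of the first part are those of the last part for the form `-F`
    refine Iff.trans ?_ ((hfd (F₂ := -F₂) hF₁.neg hF₃.neg).trans ?_)
    · refine exists_congr fun δ => and_congr_right fun _ => forall₂_congr fun ω ξ => ?_
      rw [FrequencyTheorem.form_neg, neg_mul, le_neg]
    · constructor
      · rintro ⟨δ, P, hδ, hP, h⟩
        refine ⟨δ, -P, hδ, hP.neg, fun T hT v₀ ξ v hsol => ?_⟩
        have h' := h T hT v₀ ξ v hsol
        simp only [FrequencyTheorem.form_neg, intervalIntegral.integral_neg] at h'
        rw [FrequencyTheorem.quadForm_neg, FrequencyTheorem.quadForm_neg]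
        linarith
      · rintro ⟨δ, P, hδ, hP, h⟩
        refine ⟨δ, -P, hδ, hP.neg, fun T hT v₀ ξ v hsol => ?_⟩
        have h' := h T hT v₀ ξ v hsol
        simp only [FrequencyTheorem.form_neg, intervalIntegral.integral_neg]
        rw [FrequencyTheorem.quadForm_neg, FrequencyTheorem.quadForm_neg]
        linarith
  · obtain ⟨δ, P, hδ, hP, h⟩ := hd.1 hpos
    refine ⟨P, hP, fun T hT v₀ ξ v hsol => le_trans ?_ (h T hT v₀ ξ v hsol)⟩
    exact mul_nonneg hδ.le (intervalIntegral.integral_nonneg hT fun s _ => by positivity)
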